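/- Let $G$ be a non-trivial finite group with center $Z(G)$. A $G$-module is a finite-dimensional complex representation of $G$. A covariant of $G$ is a $G$-equivariant morphism (polynomial map) $\phi\colon V\to W$ of $G$-modules, and a rational covariant is a $G$-equivariant rational map $\psi\colon V\dashrightarrow W$ of $G$-modules. A covariant or rational covariant is called faithful if $G$ acts faithfully on its image (for a rational map, the set of its values at the points where it is defined), and its dimension is the dimension of the Zariski closure of its image in $W$. Let $\operatorname{covdim} G$ be the minimal dimension of a faithful covariant of $G$, and let $\operatorname{edim} G$ (the essential dimension) be the minimal dimension of a faithful rational covariant of $G$. Then $\operatorname{covdim} G=\operatorname{edim} G$ if and only if $Z(G)$ is non-trivial. Moreover, if $Z(G)$ is trivial, then $\operatorname{covdim} G=\operatorname{edim} G+1$. -/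

import Mathlib

/-! Finite-dimensional complex `G`-modules are taken with coordinates: such a module is a
representation of `G` on `ι → ℂ` for a finite index type `ι`.  Every finite-dimensional complex
representation is isomorphic to one of this form. -/

namespace CovariantDimension

/-- The Zariski closure of a subset of the affine space `κ → ℂ`: the common zeros of all polynomials
that vanish on it. -/
def zariskiClosure {κ : Type} (X : Set (κ → ℂ)) : Set (κ → ℂ) :=
  MvPolynomial.zeroLocus ℂ (MvPolynomial.vanishingIdeal ℂ X)

/-- The dimension of a Zariski closed subset `X` of `κ → ℂ`: the Krull dimension of its
coordinate ring. -/
noncomputable def affineDim {κ : Type} (X : Set (κ → ℂ)) : WithBot ℕ∞ :=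
  ringKrullDim (MvPolynomial κ ℂ ⧸ MvPolynomial.vanishingIdeal ℂ X)

/-- The elements of `G` other than the identity do not fix `X` pointwise.  For a `G`-stable set `X`
this says that `G` acts faithfully on `X`. -/
def ActsFaithfullyOn {G : Type*} [Group G] {κ : Type} (σ : Representation ℂ G (κ → ℂ))
    (X : Set (κ → ℂ)) : Prop :=
  ∀ g : G, (∀ w ∈ X, σ g w = w) → g = 1

/-- The map `(ι → ℂ) → (κ → ℂ)` given by a tuple of polynomials. -/
noncomputable def polyMap {ι κ : Type} (φ : κ → MvPolynomial ι ℂ) (v : ι → ℂ) : κ → ℂ :=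
  fun k => MvPolynomial.eval v (φ k)

/-- A (regular) covariant: an equivariant morphism between `G`-modules. -/
def IsCovariant {G : Type*} [Group G] {ι κ : Type} (ρ : Representation ℂ G (ι → ℂ))
    (σ : Representation ℂ G (κ → ℂ)) (φ : κ → MvPolynomial ι ℂ) : Prop :=
  ∀ (g : G) (v : ι → ℂ), polyMap φ (ρ g v) = σ g (polyMap φ v)

/-- The dimension of a morphism: the dimension of the closure of its image. -/
noncomputable def covariantDim {ι κ : Type} (φ : κ → MvPolynomial ι ℂ) : WithBot ℕ∞ :=
  affineDim (zariskiClosure (Set.range (polyMap φ)))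

/-- The dimensions of the faithful covariants of `G`. -/
def faithfulCovariantDims (G : Type*) [Group G] : Set ℕ :=
  {d | ∃ (ι κ : Type) (_ : Finite ι) (_ : Finite κ) (ρ : Representation ℂ G (ι → ℂ))
    (σ : Representation ℂ G (κ → ℂ)) (φ : κ → MvPolynomial ι ℂ),
    IsCovariant ρ σ φ ∧ ActsFaithfullyOn σ (Set.range (polyMap φ)) ∧ covariantDim φ = d}

/-- The covariant dimension: the minimal dimension of a faithful covariant. -/
noncomputable def covdim (G : Type*) [Group G] : ℕ :=
  sInf (faithfulCovariantDims G)

/-- The field of rational functions on the affine space `ι → ℂ`. -/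
abbrev RationalFunction (ι : Type) : Type := FractionRing (MvPolynomial ι ℂ)

/-- The rational function `f` is defined at the point `v` and has the value `c` there. -/
def HasValueAt {ι : Type} (f : RationalFunction ι) (v : ι → ℂ) (c : ℂ) : Prop :=
  ∃ p q : MvPolynomial ι ℂ, MvPolynomial.eval v q ≠ 0 ∧
    f = algebraMap (MvPolynomial ι ℂ) (RationalFunction ι) p / algebraMap (MvPolynomial ι ℂ) (RationalFunction ι) q ∧
    c = MvPolynomial.eval v p / MvPolynomial.eval v q

/-- The rational map `ψ`, a tuple of rational functions, is defined at the point `v` and maps it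
to `w`. -/
def RatMapsTo {ι κ : Type} (ψ : κ → RationalFunction ι) (v : ι → ℂ) (w : κ → ℂ) : Prop :=
  ∀ k, HasValueAt (ψ k) v (w k)

/-- The image of a rational map: the set of its values at the points where it is defined. -/
def ratImage {ι κ : Type} (ψ : κ → RationalFunction ι) : Set (κ → ℂ) :=
  {w | ∃ v, RatMapsTo ψ v w}

/-- A rational covariant: a rational map between `G`-modules that is `G`-equivariant. -/
def IsRationalCovariant {G : Type*} [Group G] {ι κ : Type} (ρ : Representation ℂ G (ι → ℂ))
    (σ : Representation ℂ G (κ → ℂ)) (ψ : κ → RationalFunction ι) : Prop :=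
  ∀ (g : G) (v : ι → ℂ) (w : κ → ℂ), RatMapsTo ψ v w → RatMapsTo ψ (ρ g v) (σ g w)

/-- The dimension of a rational map: the dimension of the closure of its image. -/
noncomputable def rationalCovariantDim {ι κ : Type} (ψ : κ → RationalFunction ι) : WithBot ℕ∞ :=
  affineDim (zariskiClosure (ratImage ψ))

/-- The dimensions of the faithful rational covariants of `G`. -/
def faithfulRationalCovariantDims (G : Type*) [Group G] : Set ℕ :=
  {d | ∃ (ι κ : Type) (_ : Finite ι) (_ : Finite κ) (ρ : Representation ℂ G (ι → ℂ))
    (σ : Representation ℂ G (κ → ℂ)) (ψ : κ → RationalFunction ι),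
    IsRationalCovariant ρ σ ψ ∧ ActsFaithfullyOn σ (ratImage ψ) ∧ rationalCovariantDim ψ = d}

/-- The essential dimension: the minimal dimension of a faithful rational covariant. -/
noncomputable def edim (G : Type*) [Group G] : ℕ :=
  sInf (faithfulRationalCovariantDims G)


theorem hasValueAt_algebraMap {ι : Type} (p : MvPolynomial ι ℂ) (v : ι → ℂ) (c : ℂ) :
    HasValueAt (algebraMap _ (RationalFunction ι) p) v c ↔ c = MvPolynomial.eval v p := by
  constructor
  · rintro ⟨a, b, hb, h, rfl⟩
    have hb0 : b ≠ 0 := by rintro rfl; simp at hb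
    have hb1 : algebraMap (MvPolynomial ι ℂ) (RationalFunction ι) b ≠ 0 := by
      simpa using hb0
    rw [eq_div_iff hb1, ← map_mul] at h
    have h2 := IsFractionRing.injective (MvPolynomial ι ℂ) (RationalFunction ι) h
    rw [← h2, map_mul, mul_div_cancel_right₀ _ hb]
  · rintro rfl
    exact ⟨p, 1, by simp, by simp, by simp⟩

theorem ratImage_algebraMap {ι κ : Type} (φ : κ → MvPolynomial ι ℂ) :
    ratImage (fun k => algebraMap _ (RationalFunction ι) (φ k)) = Set.range (polyMap φ) := by
  ext w
  simp only [ratImage, RatMapsTo, hasValueAt_algebraMap, Set.mem_ofPred_eq, Set.mem_range]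
  exact ⟨fun ⟨v, h⟩ => ⟨v, funext fun k => (h k).symm⟩, fun ⟨v, h⟩ => ⟨v, fun k => h ▸ rfl⟩⟩

theorem faithfulCovariantDims_subset (G : Type*) [Group G] :
    faithfulCovariantDims G ⊆ faithfulRationalCovariantDims G := by
  rintro d ⟨ι, κ, hι, hκ, ρ, σ, φ, h1, h2, h3⟩
  refine ⟨ι, κ, hι, hκ, ρ, σ, fun k => algebraMap _ (RationalFunction ι) (φ k), ?_, ?_, ?_⟩
  · intro g v w hw
    simp only [RatMapsTo, hasValueAt_algebraMap] at hw ⊢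
    obtain rfl : w = polyMap φ v := funext hw
    intro k
    rw [← h1]
    rfl
  · rwa [ratImage_algebraMap]
  · rwa [rationalCovariantDim, ratImage_algebraMap]

/-- The identity of the regular representation is a faithful covariant. -/
theorem faithfulCovariantDims_nonempty (G : Type*) [Group G] [Finite G] :
    (faithfulCovariantDims G).Nonempty := by
  classical
  obtain ⟨n, ⟨e⟩⟩ := Finite.exists_equiv_fin G
  let ρ : Representation ℂ G (Fin n → ℂ) :=
    { toFun := fun g => LinearMap.funLeft ℂ ℂ (fun i => e (g⁻¹ * e.symm i))
      map_one' := by ext; simp [LinearMap.funLeft]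
      map_mul' := fun a b => by ext; simp [LinearMap.funLeft, mul_assoc] }
  have hid : polyMap (fun k : Fin n => (MvPolynomial.X k : MvPolynomial (Fin n) ℂ)) = id := by
    funext v k; simp [polyMap]
  refine ⟨n, Fin n, Fin n, inferInstance, inferInstance, ρ, ρ, fun k => MvPolynomial.X k,
    ?_, ?_, ?_⟩
  · intro g v; rw [hid]; rfl
  · intro g hg
    rw [hid] at hg
    have h := congrFun (hg (Pi.single (e 1) 1) (by simp)) (e g)
    by_contra hne
    simp [ρ, LinearMap.funLeft, hne] at h
  · have h0 : MvPolynomial.vanishingIdeal ℂ (Set.univ : Set (Fin n → ℂ)) = ⊥ := by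
      rw [eq_bot_iff]
      intro p hp
      refine MvPolynomial.funext fun x => ?_
      simpa [MvPolynomial.coe_aeval_eq_eval] using hp x trivial
    have h1 : zariskiClosure (Set.univ : Set (Fin n → ℂ)) = Set.univ := by
      rw [zariskiClosure, h0, MvPolynomial.zeroLocus_bot]; rfl
    rw [covariantDim, hid, Set.range_id, h1, affineDim, h0,
      ringKrullDim_eq_of_ringEquiv (RingEquiv.quotientBot _),
      MvPolynomial.ringKrullDim_of_isNoetherianRing]
    simp

/-- The minimum in the definition of the covariant dimension of a finite group is attained. -/
theorem isLeast_covdim (G : Type*) [Group G] [Finite G] :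
    IsLeast (faithfulCovariantDims G) (covdim G) :=
  ⟨Nat.sInf_mem (faithfulCovariantDims_nonempty G), fun _ h => Nat.sInf_le h⟩

/-- The minimum in the definition of the essential dimension of a finite group is attained. -/
theorem isLeast_edim (G : Type*) [Group G] [Finite G] :
    IsLeast (faithfulRationalCovariantDims G) (edim G) :=
  ⟨Nat.sInf_mem ((faithfulCovariantDims_nonempty G).mono (faithfulCovariantDims_subset G)),
    fun _ h => Nat.sInf_le h⟩

end CovariantDimension

/-! The components of a rational covariant span a `G`-stable space of rational functions on which
`G` acts faithfully, and the dimension of the covariant is the transcendence degree of this space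
(`exists_algRank_eq_edim`). Conversely, a stable set with faithful action contains a finite one,
which is a covariant into a permutation module (`edim_le`, `covdim_le`). So `edim G` is the least
rank of a stable faithful set of rational functions, and `covdim G` is the same for polynomials.
Multiplication by an invariant common denominator `f` costs at most one in rank
(`covdim_le_edim_add_one`).

The other inequalities use a grading of the polynomial ring that commutes with `G`. Rational
functions expand into Laurent series, and passing to initial terms keeps stability and faithfulness
without raising the rank (`isFaithfulOn_initialSet`, `algRank_initialSet_le`).

Let `z ≠ 1` be central of order `m`. Give weight `a`, with `1 ≤ a ≤ m`, to the linear forms on which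
`z` acts by `ζ ^ a`; then `z` acts in degree `d` by `ζ ^ d`. By faithfulness some initial term has
non-zero degree, and the product of its translates, or the inverse, is an invariant `h` of positive
degree. A power of `h` makes all degrees positive at no cost in rank. Replacing `y` by `f ^ deg y *
y` respects homogeneous relations and now clears the denominators, so `covdim G ≤ edim G`.

If the center is trivial, take the initial terms of a polynomial covariant for the ordinary degree,
and form the quotients of those of equal degree. An element fixing these quotients acts by a scalar
on each initial term, hence is central, hence trivial. The quotients have degree zero, and an
initial term of non-zero degree is transcendental over them, so `edim G + 1 ≤ covdim G`. -/

namespace CovariantDimension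

/-! ### Krull dimension as transcendence degree -/

section KrullDimension

/-- Incomparability makes contraction of primes strictly monotone; lying over and going up lift
every chain of primes of `R` to `S`. -/
theorem ringKrullDim_eq_of_isIntegral {R S : Type*} [CommRing R] [CommRing S] [Algebra R S]
    [Algebra.IsIntegral R S] (hinj : Function.Injective (algebraMap R S)) :
    ringKrullDim S = ringKrullDim R := by
  apply le_antisymm
  · exact Order.krullDim_le_of_strictMono (PrimeSpectrum.comap (algebraMap R S))
      fun P Q h => Ideal.IsIntegral.comap_lt_comap h
  · refine iSup_le fun l => ?_
    have : Algebra.HasGoingUp R S := ⟨fun {q} _ P _ h => by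
      obtain ⟨Q, h1, h2, h3⟩ := Ideal.exists_ideal_over_prime_of_isIntegral_of_isPrime q P h.le
      exact ⟨Q, h1, h2, ⟨h3.symm⟩⟩⟩
    obtain ⟨P, -, hP, hPl⟩ := Ideal.exists_ideal_over_prime_of_isIntegral
      l.head.asIdeal (⊥ : Ideal S) (by
        rw [← RingHom.ker_eq_comap_bot, (RingHom.injective_iff_ker_eq_bot _).1 hinj]
        exact bot_le)
    have : P.LiesOver l.head.asIdeal := ⟨hPl.symm⟩
    obtain ⟨L, hL, -⟩ := Ideal.exists_ltSeries_of_hasGoingUp l P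
    exact le_iSup_of_le L (by simp [hL])

variable {k K : Type*} [Field k] [Field K] [Algebra k K]

variable (k) in
/-- The maximal number of algebraically independent elements of `X`. -/
noncomputable def algRank (X : Set K) : ℕ∞ := (AlgebraicIndependent.matroid k K).eRk X

theorem algRank_mono {X Y : Set K} (h : X ⊆ Y) : algRank k X ≤ algRank k Y :=
  Matroid.eRk_mono _ h

theorem algRank_le_iff {X : Set K} {n : ℕ∞} : algRank k X ≤ n ↔
    ∀ I ⊆ X, AlgebraicIndependent k ((↑) : I → K) → I.encard ≤ n := by
  rw [algRank, Matroid.eRk_le_iff]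
  rfl

variable (k) in
/-- The elements that are algebraic over the algebra generated by `X`, a subfield of `K`. -/
noncomputable def algSpan (X : Set K) : Subalgebra (Algebra.adjoin k X) K :=
  Subalgebra.algebraicClosure (Algebra.adjoin k X) K

theorem mem_algSpan {X : Set K} {a : K} :
    a ∈ algSpan k X ↔ a ∈ (AlgebraicIndependent.matroid k K).closure X := by
  rw [AlgebraicIndependent.matroid_closure_eq]
  rfl

theorem subset_algSpan (X : Set K) : X ⊆ algSpan k X := fun x hx => by
  rw [SetLike.mem_coe, mem_algSpan]
  exact Matroid.mem_closure_of_mem _ hx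

theorem algRank_le_of_subset_algSpan {X Y : Set K} (h : X ⊆ algSpan k Y) :
    algRank k X ≤ algRank k Y := by
  rw [algRank, algRank, ← Matroid.eRk_closure_eq _ Y]
  exact Matroid.eRk_mono _ fun x hx => mem_algSpan.1 (h hx)

theorem adjoin_subset_algSpan (X : Set K) : (Algebra.adjoin k X : Set K) ⊆ algSpan k X :=
  fun x hx => (algSpan k X).algebraMap_mem (⟨x, hx⟩ : Algebra.adjoin k X)

theorem inv_mem_algSpan {X : Set K} {a : K} (h : a ∈ algSpan k X) : a⁻¹ ∈ algSpan k X :=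
  IsAlgebraic.inv h

theorem algRank_insert_le (X : Set K) (a : K) : algRank k (insert a X) ≤ algRank k X + 1 :=
  Matroid.eRk_insert_le_add_one _ _ _

theorem algRank_add_one_le {X : Set K} {a : K} (h : a ∉ algSpan k X) :
    algRank k X + 1 ≤ algRank k (insert a X) := by
  rw [algRank, algRank, Matroid.eRk_insert_eq_add_one]
  exact ⟨Set.mem_univ _, fun h' => h (mem_algSpan.2 h')⟩

/-- The Krull dimension of a finitely generated subalgebra of a field is the maximal number of its
algebraically independent elements. -/
theorem ringKrullDim_quotient_ker_aeval {κ : Type*} [Finite κ] (x : κ → K) :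
    ringKrullDim (MvPolynomial κ k ⧸ RingHom.ker (MvPolynomial.aeval x : MvPolynomial κ k →ₐ[k] K))
      = (algRank k (Set.range x) : ℕ∞) := by
  refine (ringKrullDim_eq_of_ringEquiv (RingHom.quotientKerEquivRange
    (MvPolynomial.aeval x : MvPolynomial κ k →ₐ[k] K).toRingHom)).trans ?_
  change ringKrullDim (MvPolynomial.aeval x : MvPolynomial κ k →ₐ[k] K).range = _
  set A := (MvPolynomial.aeval x : MvPolynomial κ k →ₐ[k] K).range with hA
  have hAadj : A = Algebra.adjoin k (Set.range x) := (Algebra.adjoin_range_eq_range_aeval k x).symm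
  have : Algebra.FiniteType k A := .of_surjective
    (MvPolynomial.aeval x : MvPolynomial κ k →ₐ[k] K).rangeRestrict
    (AlgHom.rangeRestrict_surjective _)
  -- Noether normalization: both sides turn out to be the number `s` of variables of a polynomial
  -- ring over which `A` is integral.
  obtain ⟨s, g, ginj, gint⟩ := exists_integral_inj_algHom_of_fg k A
  let _ := g.toRingHom.toAlgebra
  have : Algebra.IsIntegral (MvPolynomial (Fin s) k) A := ⟨gint⟩
  rw [ringKrullDim_eq_of_isIntegral (R := MvPolynomial (Fin s) k) (S := A) ginj,
    MvPolynomial.ringKrullDim_of_isNoetherianRing, ringKrullDim_eq_zero_of_field]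
  let y : Fin s → K := fun i => (g (MvPolynomial.X i) : K)
  have hy : (MvPolynomial.aeval y : MvPolynomial (Fin s) k →ₐ[k] K) = A.val.comp g := by
    ext i
    simp [y]
  have yind : AlgebraicIndependent k y := by
    rw [algebraicIndependent_iff_injective_aeval, hy]
    exact Subtype.val_injective.comp ginj
  have h1 : algRank k (Set.range y) = s := by
    rw [algRank, Matroid.Indep.eRk_eq_encard (M := AlgebraicIndependent.matroid k K)
      (I := Set.range y) (AlgebraicIndependent.coe_range yind), ← Set.image_univ,
      yind.injective.injOn.encard_image, Set.encard_univ]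
    simp
  have h2 : algRank k (Set.range x) = algRank k (Set.range y) := by
    apply le_antisymm <;> apply algRank_le_of_subset_algSpan
    -- An integral equation over the polynomial ring is carried by `g` to a monic equation over
    -- `k[y]`.
    · have key : ∀ a : A, (a : K) ∈ algSpan k (Set.range y) := by
        intro a
        obtain ⟨p, hp, hpa⟩ := gint a
        have hmem : ∀ q, ((g q : A) : K) ∈ Algebra.adjoin k (Set.range y) := fun q => by
          rw [Algebra.adjoin_range_eq_range_aeval]
          exact ⟨q, by simp [hy]⟩
        let φ : MvPolynomial (Fin s) k →+* Algebra.adjoin k (Set.range y) :=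
          (A.val.comp g).toRingHom.codRestrict _ hmem
        refine IsIntegral.isAlgebraic ⟨p.map φ, hp.map φ, ?_⟩
        rw [Polynomial.eval₂_map]
        have := congrArg A.val hpa
        rw [map_zero] at this
        rw [← this]
        exact (Polynomial.hom_eval₂ p g.toRingHom A.val.toRingHom a).symm
      rintro _ ⟨i, rfl⟩
      exact key ⟨x i, by rw [hAadj]; exact Algebra.subset_adjoin ⟨i, rfl⟩⟩
    · rintro _ ⟨i, rfl⟩
      apply adjoin_subset_algSpan
      rw [SetLike.mem_coe, ← hAadj]
      exact (g (MvPolynomial.X i)).2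
  rw [h2, h1]
  simp

end KrullDimension

/-! ### Values of rational functions and the closure of the image -/

section Values

variable {ι κ : Type}

theorem HasValueAt.unique {f : RationalFunction ι} {v : ι → ℂ} {c d : ℂ}
    (hc : HasValueAt f v c) (hd : HasValueAt f v d) : c = d := by
  obtain ⟨p, q, hq, rfl, rfl⟩ := hc
  obtain ⟨p', q', hq', h, rfl⟩ := hd
  have hq0 : algebraMap _ (RationalFunction ι) q ≠ 0 := by
    rw [Ne, FaithfulSMul.algebraMap_eq_zero_iff]; rintro rfl; simp at hq
  have hq0' : algebraMap _ (RationalFunction ι) q' ≠ 0 := by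
    rw [Ne, FaithfulSMul.algebraMap_eq_zero_iff]; rintro rfl; simp at hq'
  rw [div_eq_div_iff hq0 hq0', ← map_mul, ← map_mul] at h
  have := IsFractionRing.injective (MvPolynomial ι ℂ) (RationalFunction ι) h
  rw [div_eq_div_iff hq hq', ← map_mul, ← map_mul, this]

theorem HasValueAt.add {f g : RationalFunction ι} {v : ι → ℂ} {c d : ℂ}
    (hc : HasValueAt f v c) (hd : HasValueAt g v d) : HasValueAt (f + g) v (c + d) := by
  obtain ⟨p, q, hq, rfl, rfl⟩ := hc
  obtain ⟨p', q', hq', rfl, rfl⟩ := hd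
  have hq0 : algebraMap _ (RationalFunction ι) q ≠ 0 := by
    rw [Ne, FaithfulSMul.algebraMap_eq_zero_iff]; rintro rfl; simp at hq
  have hq0' : algebraMap _ (RationalFunction ι) q' ≠ 0 := by
    rw [Ne, FaithfulSMul.algebraMap_eq_zero_iff]; rintro rfl; simp at hq'
  refine ⟨p * q' + q * p', q * q', by simp [hq, hq'], ?_, ?_⟩
  · rw [div_add_div _ _ hq0 hq0']; simp
  · rw [div_add_div _ _ hq hq']; simp

theorem HasValueAt.mul {f g : RationalFunction ι} {v : ι → ℂ} {c d : ℂ}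
    (hc : HasValueAt f v c) (hd : HasValueAt g v d) : HasValueAt (f * g) v (c * d) := by
  obtain ⟨p, q, hq, rfl, rfl⟩ := hc
  obtain ⟨p', q', hq', rfl, rfl⟩ := hd
  refine ⟨p * p', q * q', by simp [hq, hq'], ?_, ?_⟩
  · rw [div_mul_div_comm]; simp
  · rw [div_mul_div_comm]; simp

theorem RatMapsTo.hasValueAt_aeval {ψ : κ → RationalFunction ι} {v : ι → ℂ} {w : κ → ℂ}
    (h : RatMapsTo ψ v w) (P : MvPolynomial κ ℂ) :
    HasValueAt (MvPolynomial.aeval ψ P) v (MvPolynomial.eval w P) := by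
  induction P using MvPolynomial.induction_on with
  | C a =>
    rw [MvPolynomial.aeval_C, MvPolynomial.eval_C,
      IsScalarTower.algebraMap_apply ℂ (MvPolynomial ι ℂ) (RationalFunction ι),
      hasValueAt_algebraMap]
    simp
  | add p q hp hq => simpa using hp.add hq
  | mul_X p k hp => simpa using hp.mul (h k)

theorem exists_forall_hasValueAt [Finite κ] (ψ : κ → RationalFunction ι) :
    ∃ q : MvPolynomial ι ℂ, q ≠ 0 ∧
      ∀ v, MvPolynomial.eval v q ≠ 0 → ∃ w, RatMapsTo ψ v w := by
  obtain ⟨⟨b, hb⟩, h⟩ :=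
    IsLocalization.exist_integer_multiples_of_finite (nonZeroDivisors (MvPolynomial ι ℂ)) ψ
  have hb0 := nonZeroDivisors.ne_zero hb
  choose p hp using h
  refine ⟨b, hb0, fun v hv => ⟨fun k => MvPolynomial.eval v (p k) / MvPolynomial.eval v b,
    fun k => ⟨p k, b, hv, ?_, rfl⟩⟩⟩
  have hb1 : algebraMap _ (RationalFunction ι) b ≠ 0 := by
    rwa [Ne, FaithfulSMul.algebraMap_eq_zero_iff]
  rw [eq_div_iff hb1, hp, mul_comm]
  exact (Algebra.smul_def b (ψ k)).symm

/-- Turns pointwise equations on a dense open set into identities of rational functions: numerator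
times denominator times `q` vanishes at every point. -/
theorem eq_zero_of_forall_hasValueAt {f : RationalFunction ι} {q : MvPolynomial ι ℂ} (hq : q ≠ 0)
    (h : ∀ v, MvPolynomial.eval v q ≠ 0 → HasValueAt f v 0) : f = 0 := by
  obtain ⟨a, b, hb, rfl⟩ := IsFractionRing.div_surjective (MvPolynomial ι ℂ) f
  have hb0 := nonZeroDivisors.ne_zero hb
  have : a * b * q = 0 := by
    refine MvPolynomial.funext fun v => ?_
    by_contra hne
    simp only [map_mul, map_zero, mul_eq_zero, not_or] at hne
    have := (h v hne.2).unique ⟨a, b, hne.1.2, rfl, rfl⟩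
    rw [eq_comm, div_eq_zero_iff] at this
    tauto
  simp only [mul_eq_zero, hq, hb0, or_false] at this
  simp [this]

theorem vanishingIdeal_zariskiClosure (X : Set (κ → ℂ)) :
    MvPolynomial.vanishingIdeal ℂ (zariskiClosure X) = MvPolynomial.vanishingIdeal ℂ X :=
  MvPolynomial.zeroLocus_vanishingIdeal_galoisConnection.u_l_u_eq_u (OrderDual.toDual X)

/-- All components are defined on a dense open set, so `P` vanishes on the image exactly when `P(ψ)
= 0`. The coordinate ring of the closure is thus the algebra generated by the components. -/
theorem vanishingIdeal_ratImage [Finite κ] (ψ : κ → RationalFunction ι) :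
    MvPolynomial.vanishingIdeal ℂ (ratImage ψ) =
      RingHom.ker (MvPolynomial.aeval ψ : MvPolynomial κ ℂ →ₐ[ℂ] RationalFunction ι) := by
  ext P
  rw [RingHom.mem_ker, MvPolynomial.mem_vanishingIdeal_iff]
  simp only [MvPolynomial.aeval_eq_eval]
  constructor
  · intro h
    obtain ⟨q, hq, hv⟩ := exists_forall_hasValueAt ψ
    refine eq_zero_of_forall_hasValueAt hq fun v hqv => ?_
    obtain ⟨w, hw⟩ := hv v hqv
    rw [← h w ⟨v, hw⟩]
    exact hw.hasValueAt_aeval P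
  · rintro h w ⟨v, hw⟩
    have h1 := hw.hasValueAt_aeval P
    rw [h] at h1
    refine h1.unique ?_
    simpa using (hasValueAt_algebraMap (0 : MvPolynomial ι ℂ) v 0).2 (by simp)

theorem rationalCovariantDim_eq [Finite κ] (ψ : κ → RationalFunction ι) :
    rationalCovariantDim ψ = (algRank ℂ (Set.range ψ) : ℕ∞) := by
  rw [rationalCovariantDim, affineDim, vanishingIdeal_zariskiClosure, vanishingIdeal_ratImage,
    ringKrullDim_quotient_ker_aeval]

open Classical in
/-- The linear forms `w ↦ (A w) k` on `κ → ℂ`. -/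
theorem exists_linearForm [Finite κ] (A : (κ → ℂ) →ₗ[ℂ] (κ → ℂ)) (k : κ) :
    ∃ P : MvPolynomial κ ℂ, (∀ w, MvPolynomial.eval w P = A w k) ∧
      ∀ ψ : κ → RationalFunction ι, MvPolynomial.aeval ψ P ∈ Submodule.span ℂ (Set.range ψ) := by
  have := Fintype.ofFinite κ
  refine ⟨∑ j, MvPolynomial.C (A (Pi.single j 1) k) * MvPolynomial.X j, fun v => ?_, fun ψ => ?_⟩
  · conv_rhs => rw [← LinearMap.sum_single_apply (fun _ => ℂ) v]
    simp only [map_sum, map_mul, MvPolynomial.eval_C, MvPolynomial.eval_X]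
    rw [Finset.sum_apply]
    refine Finset.sum_congr rfl fun j _ => ?_
    have : (Pi.single j (v j) : κ → ℂ) = v j • Pi.single j 1 := by
      rw [← Pi.single_smul]; simp
    simp [this, mul_comm]
  · simp only [map_sum, map_mul, MvPolynomial.aeval_C, MvPolynomial.aeval_X]
    refine Submodule.sum_mem _ fun j _ => ?_
    rw [← Algebra.smul_def]
    exact Submodule.smul_mem _ _ (Submodule.subset_span ⟨j, rfl⟩)

end Values

/-! ### The action on functions; stable and faithful sets -/

section Action

variable {G : Type*} [Group G] {ι : Type} [Fintype ι]

/-- The coordinate functions of `v ↦ ρ g⁻¹ v`. -/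
noncomputable def actionForm (ρ : Representation ℂ G (ι → ℂ)) (g : G) (i : ι) : MvPolynomial ι ℂ :=
  open Classical in
  ∑ j, MvPolynomial.C (ρ g⁻¹ (Pi.single j 1) i) * MvPolynomial.X j

theorem eval_actionForm (ρ : Representation ℂ G (ι → ℂ)) (g : G) (i : ι) (v : ι → ℂ) :
    MvPolynomial.eval v (actionForm ρ g i) = ρ g⁻¹ v i := by
  classical
  conv_rhs => rw [← LinearMap.sum_single_apply (fun _ => ℂ) v]
  simp only [actionForm, map_sum, map_mul, MvPolynomial.eval_C, MvPolynomial.eval_X]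
  rw [Finset.sum_apply]
  refine Finset.sum_congr rfl fun j _ => ?_
  have : (Pi.single j (v j) : ι → ℂ) = v j • Pi.single j 1 := by
    rw [← Pi.single_smul]; simp
  simp [this, mul_comm]

theorem eval_aeval_actionForm (ρ : Representation ℂ G (ι → ℂ)) (g : G) (p : MvPolynomial ι ℂ)
    (v : ι → ℂ) : MvPolynomial.eval v (MvPolynomial.aeval (actionForm ρ g) p) =
      MvPolynomial.eval (ρ g⁻¹ v) p := by
  induction p using MvPolynomial.induction_on with
  | C a => simp
  | add p q hp hq => simp only [map_add, hp, hq]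
  | mul_X p i hp =>
    simp only [map_mul, hp, MvPolynomial.aeval_X, MvPolynomial.eval_X, eval_actionForm]

theorem aeval_actionForm_aeval (ρ : Representation ℂ G (ι → ℂ)) (g h : G) (p : MvPolynomial ι ℂ) :
    MvPolynomial.aeval (actionForm ρ g) (MvPolynomial.aeval (actionForm ρ h) p) =
      MvPolynomial.aeval (actionForm ρ (g * h)) p := by
  refine MvPolynomial.funext fun v => ?_
  rw [eval_aeval_actionForm, eval_aeval_actionForm, eval_aeval_actionForm, mul_inv_rev, map_mul]
  rfl

theorem aeval_actionForm_one (ρ : Representation ℂ G (ι → ℂ)) (p : MvPolynomial ι ℂ) :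
    MvPolynomial.aeval (actionForm ρ 1) p = p := by
  refine MvPolynomial.funext fun v => ?_
  rw [eval_aeval_actionForm, inv_one, map_one]
  rfl

/-- The action of `G` on the polynomial functions, `(g • p) v = p (g⁻¹ • v)`. -/
noncomputable def polyAction (ρ : Representation ℂ G (ι → ℂ)) :
    G →* (MvPolynomial ι ℂ ≃ₐ[ℂ] MvPolynomial ι ℂ) where
  toFun g := AlgEquiv.ofAlgHom (MvPolynomial.aeval (actionForm ρ g))
    (MvPolynomial.aeval (actionForm ρ g⁻¹))
    (AlgHom.ext fun p => (aeval_actionForm_aeval ρ g g⁻¹ p).trans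
      (by rw [mul_inv_cancel, aeval_actionForm_one]; rfl))
    (AlgHom.ext fun p => (aeval_actionForm_aeval ρ g⁻¹ g p).trans
      (by rw [inv_mul_cancel, aeval_actionForm_one]; rfl))
  map_one' := AlgEquiv.ext fun p => aeval_actionForm_one ρ p
  map_mul' g h := AlgEquiv.ext fun p => (aeval_actionForm_aeval ρ g h p).symm

theorem eval_polyAction (ρ : Representation ℂ G (ι → ℂ)) (g : G) (p : MvPolynomial ι ℂ)
    (v : ι → ℂ) : MvPolynomial.eval v (polyAction ρ g p) = MvPolynomial.eval (ρ g⁻¹ v) p :=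
  eval_aeval_actionForm ρ g p v

/-- The action of `G` on the rational functions. -/
noncomputable def ratAction (ρ : Representation ℂ G (ι → ℂ)) :
    G →* (RationalFunction ι ≃ₐ[ℂ] RationalFunction ι) :=
  (IsFractionRing.fieldEquivOfAlgEquivHom ℂ (RationalFunction ι)).comp (polyAction ρ)

theorem ratAction_algebraMap (ρ : Representation ℂ G (ι → ℂ)) (g : G) (p : MvPolynomial ι ℂ) :
    ratAction ρ g (algebraMap _ _ p) = algebraMap _ (RationalFunction ι) (polyAction ρ g p) := by
  simp [ratAction]

theorem hasValueAt_ratAction (ρ : Representation ℂ G (ι → ℂ)) {g : G} {f : RationalFunction ι}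
    {v : ι → ℂ} {c : ℂ} :
    HasValueAt (ratAction ρ g f) v c ↔ HasValueAt f (ρ g⁻¹ v) c := by
  have key : ∀ {g : G} {f : RationalFunction ι} {v : ι → ℂ} {c : ℂ},
      HasValueAt f (ρ g⁻¹ v) c → HasValueAt (ratAction ρ g f) v c := by
    rintro g f v c ⟨p, q, hq, rfl, rfl⟩
    refine ⟨polyAction ρ g p, polyAction ρ g q, by rwa [eval_polyAction], ?_, ?_⟩
    · rw [map_div₀, ratAction_algebraMap, ratAction_algebraMap]
    · rw [eval_polyAction, eval_polyAction]
  refine ⟨fun h => ?_, key⟩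
  have h1 : HasValueAt (ratAction ρ g f) (ρ (g⁻¹)⁻¹ (ρ g⁻¹ v)) c := by
    simpa [← Module.End.mul_apply, ← map_mul] using h
  simpa [← AlgEquiv.mul_apply, ← map_mul] using key h1

/-- The set `X` is stable under the action. -/
def IsStable {K : Type*} [Field K] [Algebra ℂ K] (a : G →* (K ≃ₐ[ℂ] K)) (X : Set K) : Prop :=
  ∀ g, ∀ x ∈ X, a g x ∈ X

/-- Only the identity fixes all elements of `X`. -/
def IsFaithfulOn {K : Type*} [Field K] [Algebra ℂ K] (a : G →* (K ≃ₐ[ℂ] K)) (X : Set K) : Prop :=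
  ∀ g, (∀ x ∈ X, a g x = x) → g = 1

variable {κ : Type} {ρ : Representation ℂ G (ι → ℂ)}
  {σ : Representation ℂ G (κ → ℂ)} {ψ : κ → RationalFunction ι}

/-- Equivariance holds point by point; on a dense open set this suffices to write a translate of a
component as a linear form in the components. -/
theorem IsRationalCovariant.ratAction_eq [Finite κ] (h : IsRationalCovariant ρ σ ψ) (g : G) (k : κ)
    {P : MvPolynomial κ ℂ} (hP : ∀ w, MvPolynomial.eval w P = σ g⁻¹ w k) :
    ratAction ρ g (ψ k) = MvPolynomial.aeval ψ P := by
  obtain ⟨q, hq, hv⟩ := exists_forall_hasValueAt ψ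
  rw [← sub_eq_zero]
  refine eq_zero_of_forall_hasValueAt hq fun v hqv => ?_
  obtain ⟨w, hw⟩ := hv v hqv
  have h1 := (hasValueAt_ratAction ρ).2 (h g⁻¹ v w hw k)
  have h2 := hw.hasValueAt_aeval (-P)
  have := h1.add h2
  rwa [map_neg, map_neg, hP, ← sub_eq_add_neg, ← sub_eq_add_neg, sub_self] at this

theorem isStable_span {K : Type*} [Field K] [Algebra ℂ K] {a : G →* (K ≃ₐ[ℂ] K)} {X : Set K}
    (h : ∀ g, ∀ x ∈ X, a g x ∈ Submodule.span ℂ X) : IsStable a (Submodule.span ℂ X : Set K) :=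
  fun g _ hx => Submodule.span_le (p := (Submodule.span ℂ X).comap (a g).toLinearMap).2 (h g) hx

theorem IsRationalCovariant.isStable [Finite κ] (h : IsRationalCovariant ρ σ ψ) :
    IsStable (ratAction ρ) (Submodule.span ℂ (Set.range ψ) : Set (RationalFunction ι)) := by
  refine isStable_span ?_
  rintro g _ ⟨k, rfl⟩
  obtain ⟨P, hP, hPs⟩ := exists_linearForm (ι := ι) (σ g⁻¹) k
  rw [h.ratAction_eq g k hP]
  exact hPs ψ

theorem IsRationalCovariant.isFaithfulOn (h : IsRationalCovariant ρ σ ψ)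
    (hf : ActsFaithfullyOn σ (ratImage ψ)) :
    IsFaithfulOn (ratAction ρ) (Submodule.span ℂ (Set.range ψ) : Set (RationalFunction ι)) := by
  intro g hg
  refine inv_eq_one.1 (hf g⁻¹ ?_)
  rintro w ⟨v, hw⟩
  funext k
  have h1 := (hasValueAt_ratAction ρ).2 (h g⁻¹ v w hw k)
  rw [hg _ (Submodule.subset_span ⟨k, rfl⟩)] at h1
  exact h1.unique (hw k)

theorem span_subset_algSpan {K : Type*} [Field K] [Algebra ℂ K] (X : Set K) :
    (Submodule.span ℂ X : Set K) ⊆ algSpan ℂ X :=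
  fun _ hx => adjoin_subset_algSpan X (Algebra.span_le_adjoin ℂ X hx)

theorem algRank_span {K : Type*} [Field K] [Algebra ℂ K] (X : Set K) :
    algRank ℂ (Submodule.span ℂ X : Set K) = algRank ℂ X :=
  le_antisymm (algRank_le_of_subset_algSpan (span_subset_algSpan X))
    (algRank_mono Submodule.subset_span)

end Action

/-! ### From stable sets of functions back to covariants -/

section PermutationCovariant

variable {G : Type*} [Group G] {ι : Type} [Fintype ι] {ρ : Representation ℂ G (ι → ℂ)}
  {S : Set (RationalFunction ι)}

/-- The permutation representation on the functions on a stable set. -/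
noncomputable def permRepresentation (hS : IsStable (ratAction ρ) S) :
    Representation ℂ G (S → ℂ) where
  toFun g := LinearMap.funLeft ℂ ℂ fun s => ⟨ratAction ρ g⁻¹ s, hS _ _ s.2⟩
  map_one' := by ext; simp [LinearMap.funLeft]
  map_mul' g h := by ext; simp [LinearMap.funLeft]

theorem isRationalCovariant_permRepresentation (hS : IsStable (ratAction ρ) S) :
    IsRationalCovariant ρ (permRepresentation hS) ((↑) : S → RationalFunction ι) := by
  intro g v w hw s
  have h1 := hw ⟨ratAction ρ g⁻¹ s, hS _ _ s.2⟩
  rw [hasValueAt_ratAction, inv_inv] at h1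
  exact h1

theorem actsFaithfullyOn_permRepresentation [Finite S] (hS : IsStable (ratAction ρ) S)
    (hf : IsFaithfulOn (ratAction ρ) S) :
    ActsFaithfullyOn (permRepresentation hS) (ratImage ((↑) : S → RationalFunction ι)) := by
  intro g hg
  refine inv_eq_one.1 (hf g⁻¹ fun s hs => ?_)
  obtain ⟨q, hq, hv⟩ := exists_forall_hasValueAt ((↑) : S → RationalFunction ι)
  rw [← sub_eq_zero]
  refine eq_zero_of_forall_hasValueAt hq fun v hqv => ?_
  obtain ⟨w, hw⟩ := hv v hqv
  have h1 := hw ⟨ratAction ρ g⁻¹ s, hS _ _ hs⟩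
  have h2 : w ⟨ratAction ρ g⁻¹ s, hS _ _ hs⟩ = w ⟨s, hs⟩ := congrFun (hg w ⟨v, hw⟩) ⟨s, hs⟩
  have h3 := h1.add ((hasValueAt_algebraMap (-1) v (-1)).2 (by simp) |>.mul (hw ⟨s, hs⟩))
  rw [h2] at h3
  simpa [sub_eq_add_neg] using h3

/-- For each `g ≠ 1` choose an element that `g` moves; the orbits of the chosen elements form the
finite set. -/
theorem exists_finite_subset [Finite G] {K : Type*} [Field K] [Algebra ℂ K]
    {a : G →* (K ≃ₐ[ℂ] K)} {X : Set K} (hX : IsStable a X) (hf : IsFaithfulOn a X) :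
    ∃ S ⊆ X, S.Finite ∧ IsStable a S ∧ IsFaithfulOn a S := by
  have : ∀ g : G, ∃ x : K, g ≠ 1 → x ∈ X ∧ a g x ≠ x := fun g => by
    by_contra! h
    -- The element `0` serves only to extract `g ≠ 1`.
    have h0 := h 0
    exact h0.1 (hf g fun x hx => (h x).2 hx)
  choose x hx using this
  refine ⟨{y | ∃ g h, h ≠ 1 ∧ a g (x h) = y}, ?_, ?_, ?_, ?_⟩
  · rintro _ ⟨g, h, hh, rfl⟩
    exact hX _ _ (hx h hh).1
  · refine (Set.finite_range fun p : G × G => a p.1 (x p.2)).subset ?_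
    rintro _ ⟨g, h, -, rfl⟩
    exact ⟨(g, h), rfl⟩
  · rintro g _ ⟨g', h, hh, rfl⟩
    exact ⟨g * g', h, hh, by simp⟩
  · intro g hg
    by_contra hne
    exact (hx g hne).2 (hg _ ⟨1, g, hne, by simp⟩)

end PermutationCovariant

/-! ### Both dimensions as ranks of stable faithful sets -/

section Dimensions

variable {G : Type*} [Group G] [Finite G]

/-- The inclusion of a finite stable faithful subset of `X` is a rational covariant into a
permutation module, of dimension at most the rank of `X`. -/
theorem edim_le {ι : Type} [Fintype ι] (ρ : Representation ℂ G (ι → ℂ))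
    {X : Set (RationalFunction ι)} (hX : IsStable (ratAction ρ) X)
    (hf : IsFaithfulOn (ratAction ρ) X) {n : ℕ} (hn : algRank ℂ X ≤ n) : edim G ≤ n := by
  obtain ⟨S, hSX, hfin, hS, hSf⟩ := exists_finite_subset hX hf
  have := hfin.to_subtype
  have hr := (algRank_mono (k := ℂ) hSX).trans hn
  obtain ⟨d, hd⟩ := ENat.ne_top_iff_exists.1 (ne_top_of_le_ne_top (ENat.natCast_ne_top n) hr)
  have hmem : d ∈ faithfulRationalCovariantDims G :=
    ⟨ι, S, inferInstance, inferInstance, ρ, permRepresentation hS, (↑),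
      isRationalCovariant_permRepresentation hS, actsFaithfullyOn_permRepresentation hS hSf, by
        rw [rationalCovariantDim_eq, Subtype.range_coe, ← hd]; rfl⟩
  refine ((isLeast_edim G).2 hmem).trans ?_
  rw [← hd] at hr
  exact_mod_cast hr

theorem covdim_le {ι : Type} [Fintype ι] (ρ : Representation ℂ G (ι → ℂ))
    {X : Set (RationalFunction ι)} (hX : IsStable (ratAction ρ) X)
    (hf : IsFaithfulOn (ratAction ρ) X)
    (hpoly : X ⊆ Set.range (algebraMap (MvPolynomial ι ℂ) (RationalFunction ι)))
    {n : ℕ} (hn : algRank ℂ X ≤ n) : covdim G ≤ n := by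
  obtain ⟨S, hSX, hfin, hS, hSf⟩ := exists_finite_subset hX hf
  have := hfin.to_subtype
  have hr := (algRank_mono (k := ℂ) hSX).trans hn
  obtain ⟨d, hd⟩ := ENat.ne_top_iff_exists.1 (ne_top_of_le_ne_top (ENat.natCast_ne_top n) hr)
  choose φ hφ using fun s : S => hpoly (hSX s.2)
  have hφ' : (fun s => algebraMap _ (RationalFunction ι) (φ s)) = ((↑) : S → _) := funext hφ
  have hmem : d ∈ faithfulCovariantDims G := by
    refine ⟨ι, S, inferInstance, inferInstance, ρ, permRepresentation hS, φ, ?_, ?_, ?_⟩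
    · intro g v
      have := isRationalCovariant_permRepresentation hS g v (polyMap φ v) fun s => by
        rw [← hφ, hasValueAt_algebraMap]; rfl
      funext s
      have h1 := this s
      rw [← hφ, hasValueAt_algebraMap] at h1
      exact h1.symm
    · rw [← ratImage_algebraMap, hφ']
      exact actsFaithfullyOn_permRepresentation hS hSf
    · rw [covariantDim, ← ratImage_algebraMap, hφ', ← rationalCovariantDim, rationalCovariantDim_eq,
        Subtype.range_coe, ← hd]
      rfl
  refine ((isLeast_covdim G).2 hmem).trans ?_
  rw [← hd] at hr
  exact_mod_cast hr

variable (G) in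
-- The span is used because the components alone need not be permuted by `G`. Being a subspace, it
-- also contains the eigenvectors needed for initial terms.
theorem exists_algRank_eq_edim : ∃ (ι : Type) (_ : Fintype ι) (ρ : Representation ℂ G (ι → ℂ))
    (U : Submodule ℂ (RationalFunction ι)), IsStable (ratAction ρ) (U : Set (RationalFunction ι)) ∧
      IsFaithfulOn (ratAction ρ) (U : Set (RationalFunction ι)) ∧
      algRank ℂ (U : Set (RationalFunction ι)) = edim G := by
  obtain ⟨ι, κ, hι, hκ, ρ, σ, ψ, h1, h2, h3⟩ := (isLeast_edim G).1
  let _ := Fintype.ofFinite ι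
  refine ⟨ι, inferInstance, ρ, Submodule.span ℂ (Set.range ψ), h1.isStable, h1.isFaithfulOn h2, ?_⟩
  rw [rationalCovariantDim_eq] at h3
  rw [algRank_span]
  exact_mod_cast h3

variable (G) in
theorem exists_algRank_eq_covdim : ∃ (ι : Type) (_ : Fintype ι) (ρ : Representation ℂ G (ι → ℂ))
    (U : Submodule ℂ (RationalFunction ι)), IsStable (ratAction ρ) (U : Set (RationalFunction ι)) ∧
      IsFaithfulOn (ratAction ρ) (U : Set (RationalFunction ι)) ∧
      (U : Set (RationalFunction ι)) ⊆
        Set.range (algebraMap (MvPolynomial ι ℂ) (RationalFunction ι)) ∧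
      algRank ℂ (U : Set (RationalFunction ι)) = covdim G := by
  obtain ⟨ι, κ, hι, hκ, ρ, σ, φ, h1, h2, h3⟩ := (isLeast_covdim G).1
  let _ := Fintype.ofFinite ι
  let ψ : κ → RationalFunction ι := fun k => algebraMap _ _ (φ k)
  have hψ : IsRationalCovariant ρ σ ψ := by
    intro g v w hw k
    simp only [RatMapsTo, ψ, hasValueAt_algebraMap] at hw ⊢
    obtain rfl : w = polyMap φ v := funext hw
    rw [← h1]
    rfl
  rw [covariantDim, ← ratImage_algebraMap, ← rationalCovariantDim, rationalCovariantDim_eq] at h3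
  rw [← ratImage_algebraMap] at h2
  refine ⟨ι, inferInstance, ρ, Submodule.span ℂ (Set.range ψ), hψ.isStable, hψ.isFaithfulOn h2,
    ?_, ?_⟩
  · have : Submodule.span ℂ (Set.range ψ) ≤ LinearMap.range
        (IsScalarTower.toAlgHom ℂ (MvPolynomial ι ℂ) (RationalFunction ι)).toLinearMap := by
      rw [Submodule.span_le]
      rintro _ ⟨k, rfl⟩
      exact ⟨φ k, rfl⟩
    exact this
  · rw [algRank_span]
    exact_mod_cast h3

theorem edim_le_covdim : edim G ≤ covdim G :=
  (isLeast_edim G).2 (faithfulCovariantDims_subset G (isLeast_covdim G).1)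

end Dimensions

open MvPolynomial (aeval weightedHomogeneousComponent)

/-! ### Initial terms, homogeneous elements and algebraic independence -/

section Grading

variable {K : Type*} [Field K] (τ : K →+* HahnSeries ℤ K)

/-- The lowest coefficient of the expansion `τ x`. -/
noncomputable def initial : K →*₀ K where
  toFun x := (τ x).leadingCoeff
  map_zero' := by simp
  map_one' := by simp
  map_mul' x y := by rw [map_mul, HahnSeries.leadingCoeff_mul]

/-- The order of the expansion `τ x`. -/
noncomputable def ord (x : K) : ℤ := (τ x).order

/-- The expansion of `x` is the single term `x t ^ d`. -/
def IsHomogeneousOf (x : K) (d : ℤ) : Prop := τ x = HahnSeries.single d x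

variable {τ}

theorem initial_eq_coeff (x : K) : initial τ x = (τ x).coeff (ord τ x) := HahnSeries.leadingCoeff_eq

theorem initial_ne_zero {x : K} (hx : x ≠ 0) : initial τ x ≠ 0 := by
  simpa using hx

theorem ord_mul {x y : K} (hx : x ≠ 0) (hy : y ≠ 0) : ord τ (x * y) = ord τ x + ord τ y := by
  rw [ord, map_mul, HahnSeries.order_mul (by simpa using hx) (by simpa using hy)]
  rfl

theorem ord_one : ord τ 1 = 0 := by simp [ord]

theorem ord_pow (x : K) (n : ℕ) : ord τ (x ^ n) = n * ord τ x := by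
  rw [ord, map_pow, HahnSeries.order_pow, nsmul_eq_mul]
  rfl

theorem ord_prod {s : Type*} (I : Finset s) (u : s → K) (hu : ∀ i, u i ≠ 0) :
    ord τ (∏ i ∈ I, u i) = ∑ i ∈ I, ord τ (u i) := by
  classical
  induction I using Finset.induction_on with
  | empty => simp [ord_one]
  | insert i I hi ih =>
    rw [Finset.prod_insert hi, Finset.sum_insert hi,
      ord_mul (hu i) (Finset.prod_ne_zero_iff.2 fun j _ => hu j), ih]

theorem coeff_of_le_ord {x : K} {n : ℤ} (h : n ≤ ord τ x) :
    (τ x).coeff n = if ord τ x = n then initial τ x else 0 := by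
  split_ifs with h1
  · rw [initial_eq_coeff, h1]
  · exact HahnSeries.coeff_eq_zero_of_lt_order (lt_of_le_of_ne h (Ne.symm h1))

namespace IsHomogeneousOf

variable {x y : K} {d e : ℤ}

theorem ord_eq (hx : IsHomogeneousOf τ x d) (h0 : x ≠ 0) : ord τ x = d := by
  rw [ord, hx, HahnSeries.order_single h0]

theorem zero : IsHomogeneousOf τ 0 d := by simp [IsHomogeneousOf]

theorem one : IsHomogeneousOf τ 1 0 := by simp [IsHomogeneousOf]

theorem add (hx : IsHomogeneousOf τ x d) (hy : IsHomogeneousOf τ y d) :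
    IsHomogeneousOf τ (x + y) d := by
  rw [IsHomogeneousOf, map_add, hx, hy, HahnSeries.single_add]

theorem mul (hx : IsHomogeneousOf τ x d) (hy : IsHomogeneousOf τ y e) :
    IsHomogeneousOf τ (x * y) (d + e) := by
  rw [IsHomogeneousOf, map_mul, hx, hy, HahnSeries.single_mul_single]

theorem pow (hx : IsHomogeneousOf τ x d) (n : ℕ) : IsHomogeneousOf τ (x ^ n) (n * d) := by
  rw [IsHomogeneousOf, map_pow, hx, HahnSeries.single_pow, nsmul_eq_mul]

theorem inv (hx : IsHomogeneousOf τ x d) : IsHomogeneousOf τ x⁻¹ (-d) := by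
  rw [IsHomogeneousOf, map_inv₀, hx, HahnSeries.inv_single]

theorem div (hx : IsHomogeneousOf τ x d) (hy : IsHomogeneousOf τ y e) :
    IsHomogeneousOf τ (x / y) (d - e) := by
  rw [div_eq_mul_inv, sub_eq_add_neg]
  exact hx.mul hy.inv

theorem prod {s : Type*} {I : Finset s} {u : s → K} {d : s → ℤ}
    (h : ∀ i, IsHomogeneousOf τ (u i) (d i)) :
    IsHomogeneousOf τ (∏ i ∈ I, u i) (∑ i ∈ I, d i) := by
  classical
  induction I using Finset.induction_on with
  | empty => simpa using one
  | insert i I hi ih =>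
    rw [Finset.prod_insert hi, Finset.sum_insert hi]
    exact (h i).mul ih

end IsHomogeneousOf

variable [Algebra ℂ K]

theorem aeval_weightedHomogeneousComponent {s : Type*} (u : s → K) (d : s → ℤ) (n : ℤ)
    (P : MvPolynomial s ℂ) : aeval u (weightedHomogeneousComponent d n P) =
      ∑ m ∈ P.support, if Finsupp.weight d m = n then
        algebraMap ℂ K (P.coeff m) * ∏ i ∈ m.support, u i ^ m i else 0 := by
  classical
  rw [MvPolynomial.weightedHomogeneousComponent_apply, map_sum, Finset.sum_filter]
  refine Finset.sum_congr rfl fun m _ => ?_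
  split_ifs
  · rw [MvPolynomial.aeval_monomial]
    rfl
  · rfl

theorem weight_eq_sum {s : Type*} (d : s → ℤ) (m : s →₀ ℕ) :
    Finsupp.weight d m = ∑ i ∈ m.support, (m i : ℤ) * d i := by
  simp [Finsupp.weight_apply, Finsupp.sum]

omit [Algebra ℂ K] in
theorem zpow_sum₀ {s : Type*} {f : K} (hf : f ≠ 0) (I : Finset s) (n : s → ℤ) :
    f ^ (∑ i ∈ I, n i) = ∏ i ∈ I, f ^ n i := by
  classical
  induction I using Finset.induction_on with
  | empty => simp
  | insert i I hi ih => rw [Finset.sum_insert hi, Finset.prod_insert hi, zpow_add₀ hf, ih]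

variable (hC : ∀ c : ℂ, IsHomogeneousOf τ (algebraMap ℂ K c) 0)

include hC

/-- Algebraic independence of initial terms implies algebraic independence. -/
theorem algebraicIndependent_of_initial {s : Type*} {u : s → K}
    (h : AlgebraicIndependent ℂ fun i => initial τ (u i)) : AlgebraicIndependent ℂ u := by
  classical
  have hu : ∀ i, u i ≠ 0 := fun i h0 => h.ne_zero i (by simp [h0])
  rw [algebraicIndependent_iff] at h ⊢
  intro P hP
  by_contra hne
  let d : s → ℤ := fun i => ord τ (u i)
  -- At the least weight occurring in `P`, the coefficient of the expansion of `P(u)` sees only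
  -- initial terms, and it is the lowest weighted component of `P` evaluated at them.
  obtain ⟨m₀, hm₀, hmin⟩ := Finset.exists_min_image P.support (Finsupp.weight d)
    (Finset.nonempty_iff_ne_empty.2 (by simpa using hne))
  have hordm : ∀ m : s →₀ ℕ, ord τ (∏ i ∈ m.support, u i ^ m i) = Finsupp.weight d m := fun m => by
    rw [ord_prod _ _ fun i => pow_ne_zero _ (hu i), weight_eq_sum]
    simp [ord_pow, d]
  have hcomp := h (weightedHomogeneousComponent d (Finsupp.weight d m₀) P) (by
    rw [aeval_weightedHomogeneousComponent]
    have h1 := congrArg (fun x => (τ x).coeff (Finsupp.weight d m₀)) hP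
    simp only [MvPolynomial.aeval_def, MvPolynomial.eval₂_eq, map_sum, map_mul, map_zero,
      HahnSeries.coeff_zero, HahnSeries.coeff_sum] at h1
    refine Eq.trans (Finset.sum_congr rfl fun m hm => ?_) h1
    rw [hC, HahnSeries.coeff_single_zero_mul,
      coeff_of_le_ord (by rw [hordm]; exact hmin m hm), hordm]
    simp)
  have := congrArg (MvPolynomial.coeff m₀) hcomp
  rw [MvPolynomial.coeff_weightedHomogeneousComponent, if_pos rfl, MvPolynomial.coeff_zero] at this
  exact MvPolynomial.mem_support_iff.1 hm₀ this

/-- Homogeneous elements stay algebraically dependent when they are rescaled by the powers of an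
element prescribed by their degrees. -/
theorem algebraicIndependent_of_rescale {s : Type*} {u : s → K} {d : s → ℤ}
    (hu : ∀ i, IsHomogeneousOf τ (u i) (d i)) {f : K} (hf : f ≠ 0)
    (h : AlgebraicIndependent ℂ fun i => f ^ d i * u i) : AlgebraicIndependent ℂ u := by
  classical
  rw [algebraicIndependent_iff] at h ⊢
  intro P hP
  by_contra hne
  obtain ⟨m₀, hm₀⟩ := Finset.nonempty_iff_ne_empty.2 (show P.support ≠ ∅ by simpa using hne)
  set n := Finsupp.weight d m₀ with hn
  -- The coefficient in degree `n` isolates the component of weight `n`, so each component is itself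
  -- a relation among the `u i`.
  have h0 : aeval u (weightedHomogeneousComponent d n P) = 0 := by
    rw [aeval_weightedHomogeneousComponent]
    have h1 := congrArg (fun x => (τ x).coeff n) hP
    simp only [MvPolynomial.aeval_def, MvPolynomial.eval₂_eq, map_sum, map_zero,
      HahnSeries.coeff_zero, HahnSeries.coeff_sum] at h1
    refine Eq.trans (Finset.sum_congr rfl fun m hm => ?_) h1
    have h2 := (hC (P.coeff m)).mul
      (IsHomogeneousOf.prod (I := m.support) fun i => (hu i).pow (m i))
    rw [← weight_eq_sum, zero_add] at h2
    rw [h2, HahnSeries.coeff_single]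
    simp [eq_comm]
  -- On monomials of weight `n` the rescaling is multiplication by the common factor `f ^ n`.
  have hcomp := h (weightedHomogeneousComponent d n P) (by
    rw [aeval_weightedHomogeneousComponent] at h0 ⊢
    refine Eq.trans ?_ ((congrArg (f ^ n * ·) h0).trans (mul_zero _))
    simp only [Finset.mul_sum]
    refine Finset.sum_congr rfl fun m hm => ?_
    split_ifs with hmn
    · have : ∏ i ∈ m.support, (f ^ d i * u i) ^ m i =
          f ^ n * ∏ i ∈ m.support, u i ^ m i := by
        rw [← hmn, weight_eq_sum, zpow_sum₀ hf, ← Finset.prod_mul_distrib]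
        refine Finset.prod_congr rfl fun i _ => ?_
        rw [mul_pow, mul_comm (m i : ℤ), zpow_mul, zpow_natCast]
      rw [this]
      ring
    · simp)
  have := congrArg (MvPolynomial.coeff m₀) hcomp
  rw [MvPolynomial.coeff_weightedHomogeneousComponent, if_pos rfl, MvPolynomial.coeff_zero] at this
  exact MvPolynomial.mem_support_iff.1 hm₀ this

omit hC in
-- An independent subset of the image is in bijection with a subset of `Y`, which is independent by
-- hypothesis.
theorem algRank_image_le {Y : Set K} {f : K → K}
    (h : ∀ I : Set K, I ⊆ Y → AlgebraicIndependent ℂ (fun i : I => f i) →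
      AlgebraicIndependent ℂ ((↑) : I → K)) : algRank ℂ (f '' Y) ≤ algRank ℂ Y := by
  rw [algRank_le_iff]
  intro J hJ hind
  obtain ⟨I, hIY, hbij⟩ := (Set.SurjOn.exists_bijOn_subset (f := f) (s := Y) (t := J) hJ)
  have hI := h I hIY (by
    have := (algebraicIndependent_equiv (R := ℂ) (hbij.equiv f)).2 hind
    exact this)
  rw [← hbij.image_eq, hbij.injOn.encard_image]
  exact algRank_le_iff.1 le_rfl I hIY hI

theorem algRank_initial_le (Y : Set K) : algRank ℂ (initial τ '' Y) ≤ algRank ℂ Y :=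
  algRank_image_le fun _ _ h => algebraicIndependent_of_initial hC h

theorem algRank_rescale_le {Y : Set K} (hY : ∀ y ∈ Y, IsHomogeneousOf τ y (ord τ y)) {f : K}
    (hf : f ≠ 0) : algRank ℂ ((fun y => f ^ ord τ y * y) '' Y) ≤ algRank ℂ Y :=
  algRank_image_le fun _ hI h => algebraicIndependent_of_rescale hC (fun i => hY i (hI i.2)) hf h

/-- A homogeneous element of non-zero degree is transcendental over elements of degree zero. -/
theorem notMem_algSpan_of_isHomogeneousOf {X : Set K} (hX : ∀ x ∈ X, IsHomogeneousOf τ x 0)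
    {h : K} {d : ℤ} (hh : IsHomogeneousOf τ h d) (h0 : h ≠ 0) (hd : d ≠ 0) : h ∉ algSpan ℂ X := by
  have hadj : ∀ x ∈ Algebra.adjoin ℂ X, IsHomogeneousOf τ x 0 := fun x hx => by
    induction hx using Algebra.adjoin_induction with
    | mem x hx => exact hX x hx
    | algebraMap c => exact hC c
    | add x y _ _ hx hy => exact hx.add hy
    | mul x y _ _ hx hy => simpa using hx.mul hy
  rintro ⟨P, hP, hPh⟩
  apply hP
  ext j
  -- The coefficients of `P` have degree zero and `d ≠ 0`, so the terms of an algebraic equation for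
  -- `h` lie in distinct degrees and vanish one by one.
  have h1 := congrArg (fun x => (τ x).coeff (j * d)) hPh
  simp only [Polynomial.aeval_eq_sum_range, map_sum, map_zero, HahnSeries.coeff_zero,
    HahnSeries.coeff_sum] at h1
  have h2 : ∀ i, (τ (P.coeff i • h ^ i)).coeff (j * d) =
      if j = i then (P.coeff i • h ^ i : K) else 0 := fun i => by
    have := (hadj _ (P.coeff i).2).mul (hh.pow i)
    rw [zero_add] at this
    change (τ ((P.coeff i : K) * h ^ i)).coeff (j * d) = _
    rw [this, HahnSeries.coeff_single]
    simp only [mul_eq_mul_right_iff, hd, or_false, Nat.cast_inj]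
    rfl
  simp only [h2, Finset.sum_ite_eq, Finset.mem_range] at h1
  split_ifs at h1 with hj
  · have h3 : (P.coeff j : K) * h ^ j = 0 := h1
    simpa [h0] using h3
  · simp [Polynomial.coeff_eq_zero_of_natDegree_lt (show P.natDegree < j by omega)]

end Grading

/-! ### Eigenspace projections of an operator of finite order -/

section Eigenvectors

variable {E : Type*} [AddCommGroup E] [Module ℂ E]

/-- The projection onto the eigenspace for `ζ ^ a` of an operator `T` with `T ^ m = 1`. -/
noncomputable def eigenProj (T : E →ₗ[ℂ] E) (ζ : ℂ) (m a : ℕ) : E →ₗ[ℂ] E :=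
  (m : ℂ)⁻¹ • ∑ k ∈ Finset.range m, (ζ⁻¹) ^ (a * k) • T ^ k

variable {T : E →ₗ[ℂ] E} {ζ : ℂ} {m : ℕ}

theorem eigenProj_apply (a : ℕ) (x : E) :
    eigenProj T ζ m a x = (m : ℂ)⁻¹ • ∑ k ∈ Finset.range m, (ζ⁻¹) ^ (a * k) • (T ^ k) x := by
  simp [eigenProj]

/-- Applying `T` shifts the summation index by one, and the sum is cyclic because `T ^ m = 1` and `ζ
^ m = 1`. -/
theorem apply_eigenProj (hm : m ≠ 0) (hT : T ^ m = 1) (hζ : ζ ^ m = 1) (a : ℕ) (x : E) :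
    T (eigenProj T ζ m a x) = ζ ^ a • eigenProj T ζ m a x := by
  have hζ0 : ζ ≠ 0 := by rintro rfl; simp [hm] at hζ
  have hstep : ∀ k, T ((ζ⁻¹) ^ (a * k) • (T ^ k) x) =
      ζ ^ a • ((ζ⁻¹) ^ (a * (k + 1)) • (T ^ (k + 1)) x) := fun k => by
    rw [map_smul, pow_succ' T, Module.End.mul_apply, smul_smul, mul_add, pow_add, mul_one,
      mul_left_comm, ← mul_pow, mul_inv_cancel₀ hζ0, one_pow, mul_one]
  rw [eigenProj_apply, map_smul, map_sum, Finset.sum_congr rfl fun k _ => hstep k,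
    ← Finset.smul_sum, smul_comm]
  congr 2
  have h1 := Finset.sum_range_succ (fun k => (ζ⁻¹) ^ (a * k) • (T ^ k) x) m
  rw [Finset.sum_range_succ'] at h1
  have h2 : (ζ⁻¹) ^ (a * m) • (T ^ m) x = (ζ⁻¹) ^ (a * 0) • (T ^ 0) x := by
    rw [hT, mul_comm, pow_mul, inv_pow, hζ]
    simp
  rw [h2] at h1
  exact add_right_cancel h1

theorem sum_inv_pow (hζ : IsPrimitiveRoot ζ m) {k : ℕ} (hk : k ∈ Finset.range m) :
    ∑ a ∈ Finset.range m, (ζ⁻¹) ^ ((a + 1) * k) = if k = 0 then (m : ℂ) else 0 := by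
  split_ifs with h0
  · simp [h0]
  · have hne : (ζ⁻¹) ^ k ≠ 1 := hζ.inv.pow_ne_one_of_pos_of_lt h0 (Finset.mem_range.1 hk)
    have h1 : ((ζ⁻¹) ^ k) ^ m = 1 := by rw [pow_right_comm, hζ.inv.pow_eq_one, one_pow]
    have h2 := geom_sum_eq hne m
    rw [h1, sub_self, zero_div] at h2
    have : ∀ a, (ζ⁻¹) ^ ((a + 1) * k) = (ζ⁻¹) ^ k * ((ζ⁻¹) ^ k) ^ a := fun a => by
      rw [← pow_mul, ← pow_add]; congr 1; ring
    simp only [this, ← Finset.mul_sum, h2, mul_zero]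

/-- Orthogonality of characters of the cyclic group of order `m`. The exponents run over `1, …, m`
and not `0, …, m - 1`, because they become weights that must be positive. -/
theorem sum_eigenProj (hm : m ≠ 0) (hζ : IsPrimitiveRoot ζ m) (x : E) :
    ∑ a ∈ Finset.range m, eigenProj T ζ m (a + 1) x = x := by
  have hm' : (m : ℂ) ≠ 0 := by exact_mod_cast hm
  simp only [eigenProj_apply]
  rw [← Finset.smul_sum, Finset.sum_comm]
  simp only [← Finset.sum_smul]
  rw [Finset.sum_congr rfl fun k hk => by rw [sum_inv_pow hζ hk]]
  simp only [ite_smul, zero_smul, Finset.sum_ite_eq', Finset.mem_range, Nat.pos_of_ne_zero hm,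
    if_true, pow_zero, Module.End.one_apply]
  rw [smul_smul, inv_mul_cancel₀ hm', one_smul]

theorem pow_apply_of_apply_eq_smul {x : E} {c : ℂ} (h : T x = c • x) (k : ℕ) :
    (T ^ k) x = c ^ k • x := by
  induction k with
  | zero => simp
  | succ k ih => rw [pow_succ, Module.End.mul_apply, h, map_smul, ih, smul_smul, pow_succ']

theorem eigenProj_eigenProj (hm : m ≠ 0) (hT : T ^ m = 1) (hζ : IsPrimitiveRoot ζ m) {a b : ℕ}
    (ha : a < m) (hb : b < m) (x : E) : eigenProj T ζ m (b + 1) (eigenProj T ζ m (a + 1) x) =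
      if a = b then eigenProj T ζ m (a + 1) x else 0 := by
  have hm' : (m : ℂ) ≠ 0 := by exact_mod_cast hm
  have hζ0 : ζ ≠ 0 := hζ.ne_zero hm
  set y := eigenProj T ζ m (a + 1) x with hy
  have hTy : T y = ζ ^ (a + 1) • y := apply_eigenProj hm hT hζ.pow_eq_one _ _
  rw [eigenProj_apply]
  simp only [pow_apply_of_apply_eq_smul hTy, smul_smul, ← Finset.sum_smul]
  have hterm : ∀ k, (ζ⁻¹) ^ ((b + 1) * k) * (ζ ^ (a + 1)) ^ k =
      ((ζ⁻¹) ^ b * ζ ^ a) ^ k := fun k => by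
    rw [pow_mul, ← mul_pow, pow_succ, pow_succ, mul_mul_mul_comm, inv_mul_cancel₀ hζ0, mul_one]
  simp only [hterm]
  split_ifs with hab
  · subst hab
    have h1 : (ζ⁻¹) ^ a * ζ ^ a = 1 := by rw [← mul_pow, inv_mul_cancel₀ hζ0, one_pow]
    simp only [h1, one_pow, Finset.sum_const, Finset.card_range, nsmul_eq_mul, mul_one,
      inv_mul_cancel₀ hm', one_smul]
  · have hne : (ζ⁻¹) ^ b * ζ ^ a ≠ 1 := fun h => hab (hζ.pow_inj ha hb (by
      rw [inv_pow] at h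
      exact (inv_mul_eq_one₀ (pow_ne_zero _ hζ0)).1 h |>.symm))
    have h1 : ((ζ⁻¹) ^ b * ζ ^ a) ^ m = 1 := by
      rw [mul_pow, pow_right_comm, pow_right_comm ζ, hζ.inv.pow_eq_one, hζ.pow_eq_one]; simp
    have h2 := geom_sum_eq hne m
    rw [h1, sub_self, zero_div] at h2
    rw [h2, mul_zero, zero_smul]

end Eigenvectors

open MvPolynomial (aeval X)

/-! ### The grading of the polynomial ring defined by a central element -/

section WeightGrading

variable (ι : Type) in
/-- The space of linear forms. -/
noncomputable def linearForms : Submodule ℂ (MvPolynomial ι ℂ) := Submodule.span ℂ (Set.range X)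

theorem X_mem_linearForms {ι : Type} (i : ι) : (X i : MvPolynomial ι ℂ) ∈ linearForms ι :=
  Submodule.subset_span ⟨i, rfl⟩

variable {G : Type*} [Group G] {ι : Type} [Fintype ι] (ρ : Representation ℂ G (ι → ℂ))

theorem polyAction_X (g : G) (i : ι) : polyAction ρ g (X i) = actionForm ρ g i :=
  MvPolynomial.aeval_X _ _

theorem polyAction_mem_linearForms (g : G) {p : MvPolynomial ι ℂ} (hp : p ∈ linearForms ι) :
    polyAction ρ g p ∈ linearForms ι := by
  refine Submodule.span_le (p := (linearForms ι).comap (polyAction ρ g).toLinearMap).2 ?_ hp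
  rintro _ ⟨i, rfl⟩
  change polyAction ρ g (X i) ∈ linearForms ι
  rw [polyAction_X, actionForm]
  refine Submodule.sum_mem _ fun j _ => ?_
  rw [← MvPolynomial.smul_eq_C_mul]
  exact Submodule.smul_mem _ _ (X_mem_linearForms j)

/-- The operator `p ↦ z • p` on polynomials. -/
noncomputable def actionOp (z : G) : MvPolynomial ι ℂ →ₗ[ℂ] MvPolynomial ι ℂ :=
  (polyAction ρ z).toLinearMap

theorem actionOp_pow_apply (z : G) (k : ℕ) (p : MvPolynomial ι ℂ) :
    (actionOp ρ z ^ k) p = polyAction ρ (z ^ k) p := by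
  induction k generalizing p with
  | zero => simp
  | succ k ih => rw [pow_succ, Module.End.mul_apply, ih, pow_succ, map_mul]; rfl

variable (z : G) (ζ : ℂ)

/-- The component of weight `a` with respect to the action of `z`. -/
noncomputable def weightProj (a : ℕ) : MvPolynomial ι ℂ →ₗ[ℂ] MvPolynomial ι ℂ :=
  eigenProj (actionOp ρ z) ζ (orderOf z) a

theorem weightProj_mem_linearForms (a : ℕ) {p : MvPolynomial ι ℂ} (hp : p ∈ linearForms ι) :
    weightProj ρ z ζ a p ∈ linearForms ι := by
  rw [weightProj, eigenProj_apply]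
  refine Submodule.smul_mem _ _ (Submodule.sum_mem _ fun k _ => Submodule.smul_mem _ _ ?_)
  rw [actionOp_pow_apply]
  exact polyAction_mem_linearForms ρ _ hp

variable {z} in
-- The place where centrality enters: the projections are combinations of powers of `z`, which
-- commute with `g`.
theorem weightProj_polyAction (hz : z ∈ Subgroup.center G) (g : G) (a : ℕ)
    (p : MvPolynomial ι ℂ) :
    weightProj ρ z ζ a (polyAction ρ g p) = polyAction ρ g (weightProj ρ z ζ a p) := by
  simp only [weightProj, eigenProj_apply, map_smul, map_sum, actionOp_pow_apply]
  simp only [← AlgEquiv.mul_apply, ← map_mul]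
  simp only [fun k => (Subgroup.mem_center_iff.1 (pow_mem hz k) g).symm]

/-- The grading of the polynomial ring in which the linear forms on which `z` acts by `ζ ^ a`,
where `1 ≤ a ≤ orderOf z`, have weight `a`. -/
noncomputable def weightHom : MvPolynomial ι ℂ →ₐ[ℂ] Polynomial (MvPolynomial ι ℂ) :=
  aeval fun i => ∑ a ∈ Finset.range (orderOf z),
    Polynomial.monomial (a + 1) (weightProj ρ z ζ (a + 1) (X i))

theorem weightHom_linearForm {p : MvPolynomial ι ℂ} (hp : p ∈ linearForms ι) :
    weightHom ρ z ζ p = ∑ a ∈ Finset.range (orderOf z),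
      Polynomial.monomial (a + 1) (weightProj ρ z ζ (a + 1) p) := by
  induction hp using Submodule.span_induction with
  | mem x hx =>
    obtain ⟨i, rfl⟩ := hx
    exact MvPolynomial.aeval_X _ _
  | zero => simp
  | add x y _ _ hx hy => simp [hx, hy, Finset.sum_add_distrib]
  | smul c x _ hx =>
    rw [map_smul, hx, Finset.smul_sum]
    refine Finset.sum_congr rfl fun a _ => ?_
    rw [map_smul, Polynomial.smul_monomial]

variable {z} in
theorem weightHom_polyAction (hz : z ∈ Subgroup.center G) (g : G) (p : MvPolynomial ι ℂ) :
    weightHom ρ z ζ (polyAction ρ g p) =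
      (weightHom ρ z ζ p).map (polyAction ρ g : MvPolynomial ι ℂ →+* MvPolynomial ι ℂ) := by
  have : (weightHom ρ z ζ).comp (polyAction ρ g).toAlgHom =
      (Polynomial.mapAlgHom (polyAction ρ g).toAlgHom).comp (weightHom ρ z ζ) := by
    refine MvPolynomial.algHom_ext fun i => ?_
    change weightHom ρ z ζ (polyAction ρ g (X i)) = Polynomial.map _ (weightHom ρ z ζ (X i))
    rw [weightHom_linearForm _ _ _ (polyAction_mem_linearForms ρ g (X_mem_linearForms i)),
      weightHom_linearForm _ _ _ (X_mem_linearForms i), Polynomial.map_sum]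
    refine Finset.sum_congr rfl fun a _ => ?_
    rw [weightProj_polyAction ρ ζ hz, Polynomial.map_monomial]
    rfl
  exact DFunLike.congr_fun this p

/-- Algebra maps agree if they agree on the variables. Setting the grading variable to `1`, `ζ` and
`0` will give the identity, the action of `z` and the constant term. -/
theorem eval_weightHom (c : ℂ) {f : MvPolynomial ι ℂ →ₐ[ℂ] MvPolynomial ι ℂ}
    (h : ∀ i, ∑ a ∈ Finset.range (orderOf z), c ^ (a + 1) • weightProj ρ z ζ (a + 1) (X i) =
      f (X i)) (p : MvPolynomial ι ℂ) :
    (weightHom ρ z ζ p).eval (MvPolynomial.C c) = f p := by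
  have : ((Polynomial.aeval (MvPolynomial.C c : MvPolynomial ι ℂ)).restrictScalars ℂ).comp
      (weightHom ρ z ζ) = f := by
    refine MvPolynomial.algHom_ext fun i => ?_
    change Polynomial.aeval _ (weightHom ρ z ζ (X i)) = _
    rw [weightHom_linearForm _ _ _ (X_mem_linearForms i), map_sum, ← h]
    refine Finset.sum_congr rfl fun a _ => ?_
    rw [Polynomial.aeval_monomial, MvPolynomial.smul_eq_C_mul, map_pow, mul_comm]
    rfl
  exact DFunLike.congr_fun this p

variable [Finite G] {ζ} {z} (hζ : IsPrimitiveRoot ζ (orderOf z))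

include hζ

theorem eval_one_weightHom (p : MvPolynomial ι ℂ) : (weightHom ρ z ζ p).eval 1 = p := by
  have := eval_weightHom ρ z ζ 1 (f := AlgHom.id ℂ _) (fun i => by
    simp only [one_pow, one_smul]
    exact sum_eigenProj (orderOf_pos z).ne' hζ _) p
  simpa using this

omit [Finite G] hζ in
theorem actionOp_pow_orderOf : actionOp ρ z ^ orderOf z = 1 := by
  refine LinearMap.ext fun p => ?_
  rw [actionOp_pow_apply, pow_orderOf_eq_one, map_one]
  rfl

theorem eval_zeta_weightHom (p : MvPolynomial ι ℂ) :
    (weightHom ρ z ζ p).eval (MvPolynomial.C ζ) = polyAction ρ z p := by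
  refine eval_weightHom ρ z ζ ζ (f := (polyAction ρ z).toAlgHom) (fun i => ?_) p
  have hm := (orderOf_pos z).ne'
  change _ = actionOp ρ z (X i)
  conv_rhs => rw [← sum_eigenProj (T := actionOp ρ z) hm hζ (X i), map_sum]
  exact Finset.sum_congr rfl fun a _ =>
    (apply_eigenProj hm (actionOp_pow_orderOf ρ) hζ.pow_eq_one _ _).symm

omit [Finite G] hζ in
-- All weights are at least one, so setting the grading variable to zero kills every variable of the
-- polynomial ring.
theorem coeff_zero_weightHom (p : MvPolynomial ι ℂ) :
    (weightHom ρ z ζ p).coeff 0 = MvPolynomial.C (MvPolynomial.constantCoeff p) := by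
  have := eval_weightHom ρ z ζ 0 (f := aeval fun _ => (0 : MvPolynomial ι ℂ)) (by simp) p
  rw [map_zero, ← Polynomial.coeff_zero_eq_eval_zero] at this
  rw [this]
  exact MvPolynomial.aeval_zero' p

theorem weightHom_weightProj {a : ℕ} (ha : a < orderOf z) {p : MvPolynomial ι ℂ}
    (hp : p ∈ linearForms ι) : weightHom ρ z ζ (weightProj ρ z ζ (a + 1) p) =
      Polynomial.monomial (a + 1) (weightProj ρ z ζ (a + 1) p) := by
  rw [weightHom_linearForm _ _ _ (weightProj_mem_linearForms ρ z ζ _ hp),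
    Finset.sum_eq_single a]
  · rw [weightProj, eigenProj_eigenProj (orderOf_pos z).ne' (actionOp_pow_orderOf ρ) hζ ha ha,
      if_pos rfl]
  · intro b hb hba
    rw [weightProj, weightProj,
      eigenProj_eigenProj (orderOf_pos z).ne' (actionOp_pow_orderOf ρ) hζ ha (Finset.mem_range.1 hb),
      if_neg hba.symm, map_zero]
  · intro h
    exact absurd (Finset.mem_range.2 ha) h

/-- Homogeneous components are homogeneous. For variables this is orthogonality of the projections,
and it passes to products. -/
theorem weightHom_coeff_weightHom (p : MvPolynomial ι ℂ) (n : ℕ) :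
    weightHom ρ z ζ ((weightHom ρ z ζ p).coeff n) =
      Polynomial.monomial n ((weightHom ρ z ζ p).coeff n) := by
  have hX : ∀ (i : ι) (n : ℕ), weightHom ρ z ζ ((weightHom ρ z ζ (X i)).coeff n) =
      Polynomial.monomial n ((weightHom ρ z ζ (X i)).coeff n) := fun i n => by
    rw [weightHom_linearForm _ _ _ (X_mem_linearForms i), Polynomial.finsetSum_coeff, map_sum,
      map_sum]
    refine Finset.sum_congr rfl fun a ha => ?_
    rw [Polynomial.coeff_monomial]
    split_ifs with h
    · rw [weightHom_weightProj ρ hζ (Finset.mem_range.1 ha) (X_mem_linearForms i), h]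
    · simp
  induction p using MvPolynomial.induction_on generalizing n with
  | C c =>
    have : weightHom ρ z ζ (MvPolynomial.C c) = Polynomial.C (MvPolynomial.C c) :=
      (weightHom ρ z ζ).commutes c
    rw [this, Polynomial.coeff_C]
    split_ifs with h
    · rw [this, h]; rfl
    · simp
  | add p q hp hq => simp [hp, hq]
  | mul_X p i hp =>
    rw [map_mul, Polynomial.coeff_mul, map_sum, map_sum]
    refine Finset.sum_congr rfl fun ab hab => ?_
    rw [map_mul, hp, hX, Polynomial.monomial_mul_monomial,
      Finset.HasAntidiagonal.mem_antidiagonal.1 hab]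

end WeightGrading

/-! ### Laurent expansion of rational functions along the grading -/

section Expansion

/-- Polynomials over a domain as Laurent series over its field of fractions. -/
noncomputable def toSeries (ι : Type) :
    Polynomial (MvPolynomial ι ℂ) →+* HahnSeries ℤ (RationalFunction ι) :=
  (HahnSeries.ofPowerSeries ℤ (RationalFunction ι)).comp
    (Polynomial.coeToPowerSeries.ringHom.comp (Polynomial.mapRingHom (algebraMap _ _)))

theorem coeff_toSeries {ι : Type} (P : Polynomial (MvPolynomial ι ℂ)) (n : ℤ) :
    (toSeries ι P).coeff n = if n < 0 then 0 else algebraMap _ _ (P.coeff n.natAbs) := by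
  simp [toSeries, PowerSeries.coeff_coe]

theorem toSeries_injective {ι : Type} : Function.Injective (toSeries ι) := by
  intro P Q h
  ext1 n
  have := congrArg (fun x => HahnSeries.coeff x (n : ℤ)) h
  simp only [coeff_toSeries, Int.natAbs_natCast] at this
  rw [if_neg (by omega), if_neg (by omega)] at this
  exact IsFractionRing.injective (MvPolynomial ι ℂ) (RationalFunction ι) this

theorem toSeries_monomial {ι : Type} (n : ℕ) (p : MvPolynomial ι ℂ) :
    toSeries ι (Polynomial.monomial n p) = HahnSeries.single (n : ℤ) (algebraMap _ _ p) := by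
  ext k
  rw [coeff_toSeries, HahnSeries.coeff_single, Polynomial.coeff_monomial]
  by_cases hk : k < 0
  · rw [if_pos hk, if_neg (by omega)]
  · by_cases hkn : k = n
    · subst hkn; simp
    · rw [if_neg hk, if_neg (by omega), if_neg hkn, map_zero]

variable {G : Type*} [Group G] [Finite G] {ι : Type} [Fintype ι]
  (ρ : Representation ℂ G (ι → ℂ)) {z : G} {ζ : ℂ} (hζ : IsPrimitiveRoot ζ (orderOf z))

include hζ in
theorem weightHom_injective : Function.Injective (weightHom ρ z ζ) :=
  Function.LeftInverse.injective (g := Polynomial.eval 1) (eval_one_weightHom ρ hζ)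

/-- The expansion of rational functions extending `weightHom`. -/
noncomputable def expansion : RationalFunction ι →+* HahnSeries ℤ (RationalFunction ι) :=
  IsFractionRing.lift (A := MvPolynomial ι ℂ) (K := RationalFunction ι)
    (L := HahnSeries ℤ (RationalFunction ι))
    (g := (toSeries ι).comp (weightHom ρ z ζ : MvPolynomial ι ℂ →+* _))
    (toSeries_injective.comp (weightHom_injective ρ hζ))

theorem expansion_algebraMap (p : MvPolynomial ι ℂ) :
    expansion ρ hζ (algebraMap _ _ p) = toSeries ι (weightHom ρ z ζ p) :=
  IsFractionRing.lift_algebraMap _ _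

theorem expansion_algebraMap_complex (c : ℂ) :
    IsHomogeneousOf (expansion ρ hζ) (algebraMap ℂ (RationalFunction ι) c) 0 := by
  rw [IsHomogeneousOf, IsScalarTower.algebraMap_apply ℂ (MvPolynomial ι ℂ) (RationalFunction ι),
    expansion_algebraMap, AlgHom.commutes]
  exact toSeries_monomial 0 _

theorem exists_ord_algebraMap {p : MvPolynomial ι ℂ} (hp : p ≠ 0) : ∃ n : ℕ,
    ord (expansion ρ hζ) (algebraMap _ _ p) = n ∧
      initial (expansion ρ hζ) (algebraMap _ _ p) =
        algebraMap _ _ ((weightHom ρ z ζ p).coeff n) := by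
  have h0 : initial (expansion ρ hζ) (algebraMap _ _ p) ≠ 0 := initial_ne_zero (by
    rwa [Ne, FaithfulSMul.algebraMap_eq_zero_iff])
  have h1 := initial_eq_coeff (τ := expansion ρ hζ) (algebraMap _ _ p)
  rw [h1, expansion_algebraMap, coeff_toSeries] at h0
  split_ifs at h0 with h
  · exact absurd rfl h0
  refine ⟨(ord (expansion ρ hζ) (algebraMap _ _ p)).natAbs, by omega, ?_⟩
  rw [h1, expansion_algebraMap, coeff_toSeries, if_neg h]

/-- Positive weights leave only constants in degree zero. A rational function of degree zero need
not be constant, so regularity matters for this step of the trivial-center case. -/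
theorem exists_initial_eq_of_ord_eq_zero {p : MvPolynomial ι ℂ}
    (h : ord (expansion ρ hζ) (algebraMap _ _ p) = 0) :
    ∃ c : ℂ, initial (expansion ρ hζ) (algebraMap _ _ p) = algebraMap ℂ _ c := by
  rcases eq_or_ne p 0 with rfl | hp
  · exact ⟨0, by simp⟩
  · obtain ⟨n, h1, h2⟩ := exists_ord_algebraMap ρ hζ hp
    obtain rfl : n = 0 := by omega
    refine ⟨MvPolynomial.constantCoeff p, h2.trans ?_⟩
    rw [coeff_zero_weightHom, IsScalarTower.algebraMap_apply ℂ (MvPolynomial ι ℂ)]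
    rfl

/-- Initial terms are multiplicative and orders additive, so a quotient reduces to its numerator and
denominator. -/
theorem isHomogeneousOf_initial (x : RationalFunction ι) :
    IsHomogeneousOf (expansion ρ hζ) (initial (expansion ρ hζ) x) (ord (expansion ρ hζ) x) := by
  have hpoly : ∀ p : MvPolynomial ι ℂ, p ≠ 0 → IsHomogeneousOf (expansion ρ hζ)
      (initial (expansion ρ hζ) (algebraMap _ _ p)) (ord (expansion ρ hζ) (algebraMap _ _ p)) := by
    intro p hp
    obtain ⟨n, h1, h2⟩ := exists_ord_algebraMap ρ hζ hp
    rw [IsHomogeneousOf, h1, h2, expansion_algebraMap, weightHom_coeff_weightHom ρ hζ,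
      toSeries_monomial]
  rcases eq_or_ne x 0 with rfl | hx
  · rw [map_zero]
    exact .zero
  obtain ⟨p, q, hq, rfl⟩ := IsFractionRing.div_surjective (MvPolynomial ι ℂ) x
  have hq0 := nonZeroDivisors.ne_zero hq
  have hp0 : p ≠ 0 := by rintro rfl; simp at hx
  have h1 := (hpoly p hp0).div (hpoly q hq0)
  rw [← map_div₀] at h1
  convert h1 using 1
  have h2 := ord_mul (τ := expansion ρ hζ) hx
    (show algebraMap _ (RationalFunction ι) q ≠ 0 by rwa [Ne, FaithfulSMul.algebraMap_eq_zero_iff])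
  rw [div_mul_cancel₀ _ (by rwa [Ne, FaithfulSMul.algebraMap_eq_zero_iff])] at h2
  omega

/-- The action of `z` on a polynomial is its expansion evaluated at `ζ`, which on a term of degree
`n` is multiplication by `ζ ^ n`. -/
theorem ratAction_initial_self (x : RationalFunction ι) :
    ratAction ρ z (initial (expansion ρ hζ) x) =
      algebraMap ℂ _ (ζ ^ ord (expansion ρ hζ) x) * initial (expansion ρ hζ) x := by
  have hζ0 : ζ ≠ 0 := hζ.ne_zero (orderOf_pos z).ne'
  have hpoly : ∀ p : MvPolynomial ι ℂ, p ≠ 0 →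
      ratAction ρ z (initial (expansion ρ hζ) (algebraMap _ _ p)) =
      algebraMap ℂ _ (ζ ^ ord (expansion ρ hζ) (algebraMap _ _ p)) *
        initial (expansion ρ hζ) (algebraMap _ _ p) := by
    intro p hp
    obtain ⟨n, h1, h2⟩ := exists_ord_algebraMap ρ hζ hp
    rw [h1, h2, ratAction_algebraMap, ← eval_zeta_weightHom ρ hζ, weightHom_coeff_weightHom ρ hζ,
      Polynomial.eval_monomial, map_mul, mul_comm, zpow_natCast,
      IsScalarTower.algebraMap_apply ℂ (MvPolynomial ι ℂ) (RationalFunction ι), ← map_pow]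
    rfl
  rcases eq_or_ne x 0 with rfl | hx
  · simp
  obtain ⟨p, q, hq, rfl⟩ := IsFractionRing.div_surjective (MvPolynomial ι ℂ) x
  have hq0 := nonZeroDivisors.ne_zero hq
  have hp0 : p ≠ 0 := by rintro rfl; simp at hx
  have h2 := ord_mul (τ := expansion ρ hζ) hx
    (show algebraMap _ (RationalFunction ι) q ≠ 0 by rwa [Ne, FaithfulSMul.algebraMap_eq_zero_iff])
  rw [div_mul_cancel₀ _ (by rwa [Ne, FaithfulSMul.algebraMap_eq_zero_iff])] at h2
  rw [eq_sub_of_add_eq h2.symm, map_div₀, map_div₀, hpoly p hp0, hpoly q hq0, zpow_sub₀ hζ0,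
    map_div₀, mul_div_mul_comm]

variable (hz : z ∈ Subgroup.center G)

include hz

/-- Polynomials suffice: the initial term and order of a quotient are determined by those of its
numerator and denominator. -/
theorem coeff_expansion_ratAction (g : G) (p : MvPolynomial ι ℂ) (n : ℤ) :
    (expansion ρ hζ (ratAction ρ g (algebraMap _ _ p))).coeff n =
      ratAction ρ g ((expansion ρ hζ (algebraMap _ _ p)).coeff n) := by
  rw [ratAction_algebraMap, expansion_algebraMap, expansion_algebraMap, coeff_toSeries,
    coeff_toSeries, weightHom_polyAction ρ ζ hz]
  split_ifs
  · simp
  · rw [ratAction_algebraMap, Polynomial.coeff_map]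
    rfl

theorem ord_ratAction_algebraMap (g : G) {p : MvPolynomial ι ℂ} (hp : p ≠ 0) :
    ord (expansion ρ hζ) (ratAction ρ g (algebraMap _ _ p)) =
      ord (expansion ρ hζ) (algebraMap _ _ p) := by
  have hp' : algebraMap _ (RationalFunction ι) p ≠ 0 := by
    rwa [Ne, FaithfulSMul.algebraMap_eq_zero_iff]
  apply le_antisymm
  · apply HahnSeries.order_le_of_coeff_ne_zero
    rw [coeff_expansion_ratAction ρ hζ hz, ← initial_eq_coeff]
    simpa using hp'
  · apply HahnSeries.order_le_of_coeff_ne_zero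
    intro h
    refine initial_ne_zero (τ := expansion ρ hζ) (x := ratAction ρ g (algebraMap _ _ p))
      (by simpa using hp') ?_
    rw [initial_eq_coeff, coeff_expansion_ratAction ρ hζ hz]
    exact (congrArg (ratAction ρ g) h).trans (map_zero _)

theorem initial_ratAction (g : G) (x : RationalFunction ι) :
    initial (expansion ρ hζ) (ratAction ρ g x) = ratAction ρ g (initial (expansion ρ hζ) x) := by
  have hpoly : ∀ p : MvPolynomial ι ℂ, p ≠ 0 →
      initial (expansion ρ hζ) (ratAction ρ g (algebraMap _ _ p)) =
        ratAction ρ g (initial (expansion ρ hζ) (algebraMap _ _ p)) := by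
    intro p hp
    rw [initial_eq_coeff, ord_ratAction_algebraMap ρ hζ hz g hp, coeff_expansion_ratAction ρ hζ hz,
      ← initial_eq_coeff]
  obtain ⟨p, q, hq, rfl⟩ := IsFractionRing.div_surjective (MvPolynomial ι ℂ) x
  have hq0 := nonZeroDivisors.ne_zero hq
  rcases eq_or_ne p 0 with rfl | hp0
  · simp
  simp only [map_div₀, hpoly p hp0, hpoly q hq0]

theorem ord_ratAction (g : G) (x : RationalFunction ι) :
    ord (expansion ρ hζ) (ratAction ρ g x) = ord (expansion ρ hζ) x := by
  rcases eq_or_ne x 0 with rfl | hx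
  · simp
  obtain ⟨p, q, hq, rfl⟩ := IsFractionRing.div_surjective (MvPolynomial ι ℂ) x
  have hq0 := nonZeroDivisors.ne_zero hq
  have hp0 : p ≠ 0 := by rintro rfl; simp at hx
  have hq' : algebraMap _ (RationalFunction ι) q ≠ 0 := by
    rwa [Ne, FaithfulSMul.algebraMap_eq_zero_iff]
  have h2 := ord_mul (τ := expansion ρ hζ) hx hq'
  have h3 := ord_mul (τ := expansion ρ hζ) (x := ratAction ρ g (algebraMap _ _ p / algebraMap _ _ q))
    (y := ratAction ρ g (algebraMap _ _ q)) (by simpa using hx) (by simpa using hq')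
  rw [← map_mul] at h3
  rw [div_mul_cancel₀ _ hq'] at h2 h3
  rw [ord_ratAction_algebraMap ρ hζ hz g hp0, ord_ratAction_algebraMap ρ hζ hz g hq0] at h3
  omega

end Expansion

/-! ### Stability and faithfulness of the set of initial terms -/

section InitialSet

variable {G : Type*} [Group G] [Finite G] {ι : Type} [Fintype ι]
  (ρ : Representation ℂ G (ι → ℂ)) {z : G} {ζ : ℂ} (hζ : IsPrimitiveRoot ζ (orderOf z))

/-- The initial terms of the non-zero elements of `U`. -/
noncomputable def initialSet (U : Submodule ℂ (RationalFunction ι)) : Set (RationalFunction ι) :=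
  initial (expansion ρ hζ) '' {u ∈ U | u ≠ 0}

variable {ρ hζ} {U : Submodule ℂ (RationalFunction ι)}

theorem ne_zero_of_mem_initialSet {y : RationalFunction ι} (hy : y ∈ initialSet ρ hζ U) :
    y ≠ 0 := by
  obtain ⟨u, hu, rfl⟩ := hy
  exact initial_ne_zero hu.2

theorem ord_initial {u : RationalFunction ι} (hu : u ≠ 0) :
    ord (expansion ρ hζ) (initial (expansion ρ hζ) u) = ord (expansion ρ hζ) u :=
  (isHomogeneousOf_initial ρ hζ u).ord_eq (initial_ne_zero hu)

theorem isHomogeneousOf_of_mem_initialSet {y : RationalFunction ι} (hy : y ∈ initialSet ρ hζ U) :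
    IsHomogeneousOf (expansion ρ hζ) y (ord (expansion ρ hζ) y) := by
  obtain ⟨u, hu, rfl⟩ := hy
  rw [ord_initial hu.2]
  exact isHomogeneousOf_initial ρ hζ u

theorem algRank_initialSet_le :
    algRank ℂ (initialSet ρ hζ U) ≤ algRank ℂ (U : Set (RationalFunction ι)) :=
  (algRank_initial_le (expansion_algebraMap_complex ρ hζ) _).trans (algRank_mono fun _ h => h.1)

theorem isStable_initialSet (hz : z ∈ Subgroup.center G)
    (hU : IsStable (ratAction ρ) (U : Set (RationalFunction ι))) :
    IsStable (ratAction ρ) (initialSet ρ hζ U) := by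
  rintro g _ ⟨u, hu, rfl⟩
  rw [← initial_ratAction ρ hζ hz]
  exact ⟨_, ⟨hU g u hu.1, by simpa using hu.2⟩, rfl⟩

/-- If `g` fixes every initial term, decompose `u` into eigenvectors of `g` inside `U`. The initial
term of an eigenvector is scaled by the same eigenvalue, which must therefore be `1`. -/
theorem isFaithfulOn_initialSet (hz : z ∈ Subgroup.center G)
    (hU : IsStable (ratAction ρ) (U : Set (RationalFunction ι)))
    (hf : IsFaithfulOn (ratAction ρ) (U : Set (RationalFunction ι))) :
    IsFaithfulOn (ratAction ρ) (initialSet ρ hζ U) := by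
  intro g hg
  refine hf g fun u hu => ?_
  have hm := (orderOf_pos g).ne'
  have hω := Complex.isPrimitiveRoot_exp (orderOf g) hm
  set ω := Complex.exp (2 * Real.pi * Complex.I / orderOf g)
  let T : RationalFunction ι →ₗ[ℂ] RationalFunction ι := (ratAction ρ g).toLinearMap
  have hTk : ∀ (k : ℕ) (x), (T ^ k) x = ratAction ρ (g ^ k) x := fun k x => by
    induction k generalizing x with
    | zero => simp
    | succ k ih => rw [pow_succ, Module.End.mul_apply, ih, pow_succ, map_mul]; rfl
  have hT : T ^ orderOf g = 1 := LinearMap.ext fun x => by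
    rw [hTk, pow_orderOf_eq_one, map_one]; rfl
  have key : ∀ a, T (eigenProj T ω (orderOf g) (a + 1) u) =
      eigenProj T ω (orderOf g) (a + 1) u := by
    intro a
    set y := eigenProj T ω (orderOf g) (a + 1) u with hy
    have hyU : y ∈ U := by
      rw [hy, eigenProj_apply]
      refine U.smul_mem _ (U.sum_mem fun k _ => U.smul_mem _ ?_)
      rw [hTk]
      exact hU _ u hu
    have hTy : T y = ω ^ (a + 1) • y := apply_eigenProj hm hT hω.pow_eq_one _ _
    rcases eq_or_ne y 0 with h0 | h0
    · rw [h0, map_zero]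
    have h1 := hg _ ⟨y, ⟨hyU, h0⟩, rfl⟩
    rw [← initial_ratAction ρ hζ hz] at h1
    change initial (expansion ρ hζ) (T y) = _ at h1
    have hc : ∀ c : ℂ, initial (expansion ρ hζ) (algebraMap ℂ _ c) = algebraMap ℂ _ c := fun c =>
      (congrArg HahnSeries.leadingCoeff (expansion_algebraMap_complex ρ hζ c)).trans
        HahnSeries.leadingCoeff_of_single
    rw [hTy, Algebra.smul_def, map_mul, hc, mul_eq_right₀ (initial_ne_zero h0)] at h1
    rw [hTy, Algebra.smul_def, h1, one_mul]
  have hsum := sum_eigenProj (T := T) hm hω u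
  change T u = u
  conv_lhs => rw [← hsum]
  rw [map_sum, Finset.sum_congr rfl fun a _ => key a, hsum]

end InitialSet

/-! ### Invariant common denominators -/

section Denominators

variable {G : Type*} [Group G] [Finite G] {ι : Type} [Fintype ι]
  (ρ : Representation ℂ G (ι → ℂ))

/-- The product of all translates of a common denominator is invariant, and its factor at `g = 1` is
the denominator itself. -/
theorem exists_invariant_denominator {S : Set (RationalFunction ι)} (hS : S.Finite) :
    ∃ f : RationalFunction ι, f ≠ 0 ∧ (∀ g, ratAction ρ g f = f) ∧
      f ∈ Set.range (algebraMap (MvPolynomial ι ℂ) (RationalFunction ι)) ∧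
      ∀ s ∈ S, f * s ∈ Set.range (algebraMap (MvPolynomial ι ℂ) (RationalFunction ι)) := by
  have := Fintype.ofFinite G
  have := hS.to_subtype
  obtain ⟨⟨b, hb⟩, h⟩ := IsLocalization.exist_integer_multiples_of_finite
    (nonZeroDivisors (MvPolynomial ι ℂ)) ((↑) : S → RationalFunction ι)
  have hb0 := nonZeroDivisors.ne_zero hb
  have hinv : ∀ g, polyAction ρ g (∏ g', polyAction ρ g' b) = ∏ g', polyAction ρ g' b := fun g => by
    rw [map_prod]
    exact Fintype.prod_equiv (Equiv.mulLeft g) _ _ fun g' => by simp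
  refine ⟨algebraMap _ _ (∏ g, polyAction ρ g b), ?_, fun g => ?_, ⟨_, rfl⟩, fun s hs => ?_⟩
  · rw [Ne, FaithfulSMul.algebraMap_eq_zero_iff, Finset.prod_eq_zero_iff]
    rintro ⟨g, -, hg⟩
    exact hb0 (by simpa using hg)
  · rw [ratAction_algebraMap, hinv]
  · obtain ⟨p, hp⟩ := h ⟨s, hs⟩
    obtain ⟨c, hc⟩ := Finset.dvd_prod_of_mem (fun g => polyAction ρ g b) (Finset.mem_univ 1)
    simp only [map_one, AlgEquiv.one_apply] at hc
    refine ⟨c * p, ?_⟩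
    have hbs : algebraMap _ (RationalFunction ι) p = algebraMap _ _ b * s :=
      hp.trans (Algebra.smul_def b s)
    rw [hc, map_mul, map_mul, hbs]
    ring

end Denominators

/-! ### The three inequalities between the dimensions -/

section Comparison

variable {G : Type*} [Group G] [Finite G]

/-- Multiplication by an invariant keeps stability and faithfulness, and the products are algebraic
over the old functions together with the single element `f`. -/
theorem covdim_le_edim_add_one : covdim G ≤ edim G + 1 := by
  obtain ⟨ι, _, ρ, U, hU, hUf, hr⟩ := exists_algRank_eq_edim G
  obtain ⟨S, hSU, hfin, hS, hSf⟩ := exists_finite_subset hU hUf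
  obtain ⟨f, hf0, hfinv, -, hfS⟩ := exists_invariant_denominator ρ hfin
  refine covdim_le ρ (X := (f * ·) '' S) ?_ ?_ ?_ ?_
  · rintro g _ ⟨s, hs, rfl⟩
    exact ⟨_, hS g s hs, by simp [hfinv]⟩
  · refine fun g hg => hSf g fun s hs => ?_
    have := hg _ ⟨s, hs, rfl⟩
    rwa [map_mul, hfinv, mul_right_inj' hf0] at this
  · rintro _ ⟨s, hs, rfl⟩
    exact hfS s hs
  · refine (algRank_le_of_subset_algSpan (Y := insert f S) ?_).trans
      ((algRank_insert_le S f).trans ?_)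
    · rintro _ ⟨s, hs, rfl⟩
      exact mul_mem (subset_algSpan _ (Set.mem_insert f S))
        (subset_algSpan _ (Set.mem_insert_of_mem f hs))
    · push_cast
      gcongr
      exact (algRank_mono hSU).trans hr.le

theorem covdim_le_edim (hG : Subgroup.center G ≠ ⊥) : covdim G ≤ edim G := by
  have := Fintype.ofFinite G
  obtain ⟨ι, _, ρ, U, hU, hUf, hr⟩ := exists_algRank_eq_edim G
  obtain ⟨⟨z, hz⟩, hne⟩ := Subgroup.ne_bot_iff_exists_ne_one.1 hG
  have hz1 : z ≠ 1 := fun h => hne (Subtype.ext h)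
  have hζ := Complex.isPrimitiveRoot_exp (orderOf z) (orderOf_pos _).ne'
  set ζ := Complex.exp (2 * Real.pi * Complex.I / orderOf z)
  set τ := expansion ρ hζ with hτ
  have hX := isStable_initialSet (hζ := hζ) hz hU
  have hXf := isFaithfulOn_initialSet (hζ := hζ) hz hU hUf
  have hXr := (algRank_initialSet_le (ρ := ρ) (hζ := hζ) (U := U)).trans hr.le
  -- Otherwise `z` would act by `ζ ^ 0` on every initial term, contradicting faithfulness and `z ≠
  -- 1`.
  obtain ⟨h₀, hh₀, hord⟩ : ∃ y ∈ initialSet ρ hζ U, ord τ y ≠ 0 := by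
    by_contra! h
    refine hz1 (hXf _ ?_)
    rintro _ ⟨u, hu, rfl⟩
    have h1 := h _ ⟨u, hu, rfl⟩
    rw [hτ, ord_initial hu.2] at h1
    rw [ratAction_initial_self, h1, zpow_zero, map_one, one_mul]
  -- a homogeneous invariant of positive degree
  obtain ⟨h, e, he, hh0, hhom, hinv, hspan⟩ : ∃ (h : RationalFunction ι) (e : ℤ), 0 < e ∧ h ≠ 0 ∧
      IsHomogeneousOf τ h e ∧ (∀ g, ratAction ρ g h = h) ∧
      h ∈ algSpan ℂ (initialSet ρ hζ U) := by
    have hmem : ∀ g, ratAction ρ g h₀ ∈ initialSet ρ hζ U := fun g => hX g _ hh₀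
    have hhom : IsHomogeneousOf τ (∏ g, ratAction ρ g h₀) (Fintype.card G * ord τ h₀) := by
      have := IsHomogeneousOf.prod (I := Finset.univ)
        fun g => isHomogeneousOf_of_mem_initialSet (hmem g)
      simpa [ord_ratAction ρ hζ hz] using this
    have hne : ∏ g, ratAction ρ g h₀ ≠ 0 :=
      Finset.prod_ne_zero_iff.2 fun g _ => ne_zero_of_mem_initialSet (hmem g)
    have hinv : ∀ g, ratAction ρ g (∏ g', ratAction ρ g' h₀) = ∏ g', ratAction ρ g' h₀ :=
      fun g => by
        rw [map_prod]
        exact Fintype.prod_equiv (Equiv.mulLeft g) _ _ fun g' => by simp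
    have hspan : ∏ g, ratAction ρ g h₀ ∈ algSpan ℂ (initialSet ρ hζ U) :=
      prod_mem fun g _ => subset_algSpan _ (hmem g)
    have hcard : (0 : ℤ) < Fintype.card G := by exact_mod_cast Fintype.card_pos
    -- A product of negative degree is inverted; this keeps it invariant and algebraic over the
    -- initial terms.
    rcases lt_or_gt_of_ne hord with hneg | hpos
    · exact ⟨_, _, by nlinarith, inv_ne_zero hne, hhom.inv, fun g => by rw [map_inv₀, hinv],
        inv_mem_algSpan hspan⟩
    · exact ⟨_, _, by positivity, hne, hhom, hinv, hspan⟩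
  obtain ⟨S, hSX, hfin, hS, hSf⟩ := exists_finite_subset hX hXf
  -- The bound is strict so that each `y` will receive at least one factor of the denominator `f`.
  obtain ⟨N, hN⟩ : ∃ N : ℕ, ∀ y ∈ S, 0 < N * e + ord τ y := by
    refine ⟨∑ y ∈ hfin.toFinset, (ord τ y).natAbs + 1, fun y hy => ?_⟩
    have h1 : (ord τ y).natAbs ≤ ∑ y ∈ hfin.toFinset, (ord τ y).natAbs :=
      Finset.single_le_sum (f := fun y => (ord τ y).natAbs) (fun _ _ => Nat.zero_le _)
        (hfin.mem_toFinset.2 hy)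
    zify at h1 ⊢
    have h2 := neg_abs_le (ord τ y)
    have h3 := abs_nonneg (ord τ y)
    have h4 : ∑ y ∈ hfin.toFinset, |ord τ y| + 1 ≤ (∑ y ∈ hfin.toFinset, |ord τ y| + 1) * e :=
      le_mul_of_one_le_right (by omega) he
    omega
  set S' := (h ^ N * ·) '' S
  have hpow0 : h ^ N ≠ 0 := pow_ne_zero _ hh0
  have hS' : IsStable (ratAction ρ) S' := by
    rintro g _ ⟨s, hs, rfl⟩
    exact ⟨_, hS g s hs, by simp [hinv]⟩
  have hS'f : IsFaithfulOn (ratAction ρ) S' := by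
    refine fun g hg => hSf g fun s hs => ?_
    have := hg _ ⟨s, hs, rfl⟩
    rwa [map_mul, map_pow, hinv, mul_right_inj' hpow0] at this
  have hdeg : ∀ y ∈ S', IsHomogeneousOf τ y (ord τ y) ∧ 0 < ord τ y := by
    rintro _ ⟨s, hs, rfl⟩
    have h1 := (hhom.pow N).mul (isHomogeneousOf_of_mem_initialSet (hSX hs))
    rw [h1.ord_eq (mul_ne_zero hpow0 (ne_zero_of_mem_initialSet (hSX hs)))]
    exact ⟨h1, hN s hs⟩
  have hS'r : algRank ℂ S' ≤ edim G := by
    refine (algRank_le_of_subset_algSpan ?_).trans hXr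
    rintro _ ⟨s, hs, rfl⟩
    exact mul_mem (pow_mem hspan N) (subset_algSpan _ (hSX hs))
  obtain ⟨f, hf0, hfinv, hfpoly, hfS⟩ := exists_invariant_denominator ρ (hfin.image (h ^ N * ·))
  -- The denominator `f` need not be homogeneous or algebraic over `S'`; only the homogeneity of the
  -- elements of `S'` keeps the rank from growing.
  refine covdim_le ρ (X := (fun y => f ^ ord τ y * y) '' S') ?_ ?_ ?_ ((algRank_rescale_le
    (expansion_algebraMap_complex ρ hζ) (fun y hy => (hdeg y hy).1) hf0).trans hS'r)
  · rintro g _ ⟨y, hy, rfl⟩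
    refine ⟨_, hS' g y hy, ?_⟩
    simp only [hτ, ord_ratAction ρ hζ hz, map_mul, map_zpow₀, hfinv]
  · refine fun g hg => hS'f g fun y hy => ?_
    have := hg _ ⟨y, hy, rfl⟩
    rwa [map_mul, map_zpow₀, hfinv, mul_right_inj' (zpow_ne_zero _ hf0)] at this
  · rintro _ ⟨y, hy, rfl⟩
    -- In degree `n + 1` the new element is `f ^ n` times `f * y`, both polynomials.
    obtain ⟨n, hn⟩ := Int.eq_succ_of_zero_lt (hdeg y hy).2
    obtain ⟨p, hp⟩ := hfpoly
    obtain ⟨q, hq⟩ := hfS y hy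
    refine ⟨p ^ n * q, ?_⟩
    simp only
    rw [hn, map_mul, map_pow, hp, hq, zpow_add_one₀ hf0, zpow_natCast, mul_assoc]

theorem edim_add_one_le_covdim [Nontrivial G] (hG : Subgroup.center G = ⊥) :
    edim G + 1 ≤ covdim G := by
  obtain ⟨ι, _, ρ, U, hU, hUf, hpoly, hr⟩ := exists_algRank_eq_covdim G
  -- With `z = 1` and `ζ = 1` all linear forms have weight `1`, and the grading is the ordinary
  -- degree.
  have hz : (1 : G) ∈ Subgroup.center G := one_mem _
  have hζ : IsPrimitiveRoot (1 : ℂ) (orderOf (1 : G)) := by simp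
  set τ := expansion ρ hζ with hτ
  have hX := isStable_initialSet (hζ := hζ) hz hU
  have hXf := isFaithfulOn_initialSet (hζ := hζ) hz hU hUf
  have hXr := (algRank_initialSet_le (ρ := ρ) (hζ := hζ) (U := U)).trans hr.le
  have hordX : ∀ g x, ord τ (ratAction ρ g x) = ord τ x := ord_ratAction ρ hζ hz
  -- Otherwise all initial terms are constants, and every `g` fixes them.
  obtain ⟨h₀, hh₀, hord⟩ : ∃ y ∈ initialSet ρ hζ U, ord τ y ≠ 0 := by
    by_contra! h
    obtain ⟨g, hg⟩ := exists_ne (1 : G)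
    refine hg (hXf _ ?_)
    rintro _ ⟨u, hu, rfl⟩
    have h1 := h _ ⟨u, hu, rfl⟩
    rw [hτ, ord_initial hu.2] at h1
    obtain ⟨p, rfl⟩ := hpoly hu.1
    obtain ⟨c, hc⟩ := exists_initial_eq_of_ord_eq_zero ρ hζ h1
    rw [hc, AlgEquiv.commutes]
  set Y : Set (RationalFunction ι) :=
    {x | ∃ a ∈ initialSet ρ hζ U, ∃ b ∈ initialSet ρ hζ U, ord τ a = ord τ b ∧ a / b = x}
  have hYs : IsStable (ratAction ρ) Y := by
    rintro g _ ⟨a, ha, b, hb, hab, rfl⟩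
    exact ⟨_, hX g a ha, _, hX g b hb, by rw [hordX, hordX, hab], by simp⟩
  have hYf : IsFaithfulOn (ratAction ρ) Y := by
    intro g hg
    -- The quotient `c` of `g a` by `a` lies in `Y`, so `g` fixes it and `g ^ k a = c ^ k a`. Hence
    -- `c` is a root of unity, and therefore a complex number.
    have hscal : ∀ a ∈ initialSet ρ hζ U, ∃ c : ℂ,
        ratAction ρ g a = algebraMap ℂ _ c * a := by
      intro a ha
      have ha0 := ne_zero_of_mem_initialSet ha
      have hc := hg _ ⟨_, hX g a ha, a, ha, hordX g a, rfl⟩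
      set c := ratAction ρ g a / a with hcdef
      have hga : ratAction ρ g a = c * a := (div_mul_cancel₀ _ ha0).symm
      have hiter : ∀ k : ℕ, ratAction ρ (g ^ k) a = c ^ k * a := fun k => by
        induction k with
        | zero => simp
        | succ k ih =>
          rw [pow_succ', map_mul, AlgEquiv.mul_apply, ih, map_mul, map_pow, hc, hga, pow_succ,
            mul_assoc]
      have h1 := hiter (orderOf g)
      rw [pow_orderOf_eq_one, map_one, AlgEquiv.one_apply, eq_comm, mul_eq_right₀ ha0] at h1
      have hω := (Complex.isPrimitiveRoot_exp (orderOf g) (orderOf_pos g).ne').map_of_injective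
        (f := algebraMap ℂ (RationalFunction ι)) (algebraMap ℂ (RationalFunction ι)).injective
      have : NeZero (orderOf g) := ⟨(orderOf_pos g).ne'⟩
      obtain ⟨i, -, hi⟩ := hω.eq_pow_of_pow_eq_one h1
      exact ⟨_, by rw [hga, ← hi, map_pow]⟩
    -- As `g` fixes the quotient of `h a` by `a`, it scales `h a` by the same constant as `a`; so
    -- `g` and `h` commute on all initial terms.
    have hcentral : g ∈ Subgroup.center G := by
      rw [Subgroup.mem_center_iff]
      intro h
      rw [← inv_mul_eq_one]
      refine hXf _ fun a ha => ?_
      have ha0 := ne_zero_of_mem_initialSet ha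
      obtain ⟨c, hc⟩ := hscal a ha
      have h1 := hg _ ⟨_, hX h a ha, a, ha, hordX h a, rfl⟩
      rw [map_div₀, hc, div_eq_div_iff (by rw [← hc]; simpa using ha0) ha0] at h1
      have h2 : ratAction ρ g (ratAction ρ h a) = ratAction ρ h (ratAction ρ g a) := by
        refine mul_right_cancel₀ ha0 ?_
        rw [h1, hc, map_mul, AlgEquiv.commutes]
        ring
      rw [map_mul, map_mul, AlgEquiv.mul_apply, AlgEquiv.mul_apply, h2, ← AlgEquiv.mul_apply,
        ← AlgEquiv.mul_apply, ← map_mul, ← map_mul]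
      simp
    rw [hG] at hcentral
    exact Subgroup.mem_bot.1 hcentral
  have hYr : algRank ℂ Y + 1 ≤ covdim G := by
    -- Adjoining `h₀` to `Y` raises the rank by one, yet everything remains algebraic over the
    -- initial terms.
    refine (algRank_add_one_le (a := h₀) ?_).trans ((algRank_le_of_subset_algSpan ?_).trans hXr)
    · refine notMem_algSpan_of_isHomogeneousOf (expansion_algebraMap_complex ρ hζ) ?_
        (isHomogeneousOf_of_mem_initialSet hh₀) (ne_zero_of_mem_initialSet hh₀) hord
      rintro _ ⟨a, ha, b, hb, hab, rfl⟩
      have := (isHomogeneousOf_of_mem_initialSet ha).div (isHomogeneousOf_of_mem_initialSet hb)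
      rwa [hab, sub_self] at this
    · rintro _ (rfl | ⟨a, ha, b, hb, -, rfl⟩)
      · exact subset_algSpan _ hh₀
      · rw [div_eq_mul_inv]
        exact mul_mem (subset_algSpan _ ha) (inv_mem_algSpan (subset_algSpan _ hb))
  obtain ⟨m, hm⟩ := ENat.ne_top_iff_exists.1
    (ne_top_of_le_ne_top (ENat.natCast_ne_top _) (le_self_add.trans hYr))
  have h1 := edim_le ρ hYs hYf hm.ge
  rw [← hm] at hYr
  have h2 : m + 1 ≤ covdim G := by exact_mod_cast hYr
  omega

end Comparison

end CovariantDimension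

theorem theorem3p1 (G : Type*) [Group G] [Finite G] [Nontrivial G] :
    (CovariantDimension.covdim G = CovariantDimension.edim G ↔ Subgroup.center G ≠ ⊥) ∧
      (Subgroup.center G = ⊥ →
        CovariantDimension.covdim G = CovariantDimension.edim G + 1) := by
  have key : Subgroup.center G = ⊥ →
      CovariantDimension.covdim G = CovariantDimension.edim G + 1 := fun h =>
    le_antisymm CovariantDimension.covdim_le_edim_add_one
      (CovariantDimension.edim_add_one_le_covdim h)
  refine ⟨⟨fun h hG => ?_, fun hG => ?_⟩, key⟩
  · have := key hG
    omega
  · exact le_antisymm (CovariantDimension.covdim_le_edim hG) CovariantDimension.edim_le_covdim
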